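/- Let $\Delta\ge 3$. A finite $\Delta$-regular tree is a finite tree $T$ of maximum degree at most $\Delta$ in which every vertex $v$ of degree $d$ is contained in $\Delta$ half-edges: the $d$ real half-edges $(v,e)$, with $e$ an edge at $v$, and $\Delta-d$ virtual half-edges. An LCL is a triple $\Pi=(\Sigma,\mathcal V,\mathcal E)$, where $\Sigma$ is a finite set of labels, $\mathcal V$ is a set of cardinality-$\Delta$ multisets of labels, and $\mathcal E$ is a set of cardinality-$2$ multisets of labels. A labeling of all (real and virtual) half-edges of $T$ by elements of $\Sigma$ is a correct solution of $\Pi$ if the multiset of labels on the half-edges around each vertex belongs to $\mathcal V$ and the multiset of the two labels on each edge belongs to $\mathcal E$. A deterministic local algorithm of local complexity $t(n)$ is a function that maps the number of vertices $n$ together with the isomorphism type of the radius-$t(n)$ neighborhood of a vertex $u$, rooted at $u$ and equipped with the identifiers of its vertices, to a label for each half-edge at $u$. The LCL $\Pi$ is solvable in $\mathsf{LOCAL}(n^{o(1)})$ rounds if there are a function $t:\mathbb N\to\mathbb N$ with $t(n)=n^{o(1)}$ (for every $\varepsilon>0$, $t(n)\le n^{\varepsilon}$ for all sufficiently large $n$),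 a constant integer $C\ge 1$ and a deterministic local algorithm of local complexity $t(n)$ that returns a correct solution of $\Pi$ on every finite $\Delta$-regular tree, where $n$ is its number of vertices, for every assignment of distinct identifiers from $\{1,\dots,n^{C}\}$ to its vertices. For $\ell\ge 2$, a set $\mathcal V'\subseteq\mathcal V$ is $\ell$-full if the following holds for every path with $k\ge\ell$ vertices, to which virtual half-edges are added so that each vertex has $\Delta$ half-edges: whenever the half-edges around the two endpoints are labeled arbitrarily so that the multisets of labels around them are in $\mathcal V'$, the half-edges around the remaining $k-2$ vertices can be labeled with configurations from $\mathcal V'$ so that the pair of labels on each of the $k-1$ edges of the path is in $\mathcal E$. Theorem. If an LCL $\Pi=(\Sigma,\mathcal V,\mathcal E)$ on $\Delta$-regular trees is solvable in (deterministic) $\mathsf{LOCAL}(n^{o(1)})$ rounds, then there exists a non-empty $\ell$-full set $\mathcal V'\subseteq\mathcal V$ for some $\ell\ge 2$. -/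

import Mathlib

namespace RegTreeLCL

/-- An LCL on `Δ`-regular trees with label set `Λ`: a set of multisets of labels of
cardinality `Δ` (vertex configurations) and a set of unordered pairs of labels
(edge configurations). -/
structure LCL (Δ : ℕ) (Λ : Type*) where
  vertexConfigs : Set (Multiset Λ)
  card_of_mem : ∀ m ∈ vertexConfigs, Multiset.card m = Δ
  edgeConfigs : Set (Sym2 Λ)

section HalfEdges

variable {V : Type*} [Fintype V]

/-- A finite `Δ`-regular tree: a finite tree of maximum degree at most `Δ`. The missing virtual
half-edges are supplied by `HalfEdgeAt`. -/
def IsRegularTree (Δ : ℕ) (G : SimpleGraph V) [DecidableRel G.Adj] : Prop :=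
  G.IsTree ∧ ∀ v, G.degree v ≤ Δ

/-- The half-edges at the vertex `v`: one real half-edge for each neighbour `w` of `v` (standing
for `(v, {v, w})`), and `Δ - deg v` virtual half-edges. -/
abbrev HalfEdgeAt (Δ : ℕ) (G : SimpleGraph V) [DecidableRel G.Adj] (v : V) : Type _ :=
  G.neighborSet v ⊕ Fin (Δ - G.degree v)

/-- A labeling of all half-edges, real and virtual. -/
abbrev HalfEdgeLabeling (Δ : ℕ) (G : SimpleGraph V) [DecidableRel G.Adj] (Λ : Type*) : Type _ :=
  ∀ v : V, HalfEdgeAt Δ G v → Λ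

variable {Δ : ℕ} {Λ : Type*} {G : SimpleGraph V} [DecidableRel G.Adj]

/-- The multiset of labels on the half-edges at `v`. -/
def configAt (c : HalfEdgeLabeling Δ G Λ) (v : V) : Multiset Λ :=
  (Finset.univ : Finset (HalfEdgeAt Δ G v)).val.map (c v)

/-- The unordered pair of labels on the two half-edges of the edge `{u, v}`. -/
def edgeConfig (c : HalfEdgeLabeling Δ G Λ) {u v : V} (h : G.Adj u v) : Sym2 Λ :=
  s(c u (Sum.inl ⟨v, h⟩), c v (Sum.inl ⟨u, h.symm⟩))

/-- Correct solutions of an LCL. -/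
def IsSolution (P : LCL Δ Λ) (c : HalfEdgeLabeling Δ G Λ) : Prop :=
  (∀ v, configAt c v ∈ P.vertexConfigs) ∧
    ∀ (u v : V) (h : G.Adj u v), edgeConfig c h ∈ P.edgeConfigs

end HalfEdges

section Local

/-- A rooted graph whose vertices are natural numbers. It serves as the canonical representative
of the isomorphism type of a rooted graph with distinct natural number identifiers: every vertex
is replaced by its identifier. -/
structure View where
  root : ℕ
  verts : Set ℕ
  edges : Set (Sym2 ℕ)

/-- The isomorphism type of the radius-`t` neighbourhood of `v` (the subgraph induced on the
vertices at distance at most `t`), rooted at `v`, with identifiers. -/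
def viewAt {V : Type*} (G : SimpleGraph V) (ident : V → ℕ) (t : ℕ) (v : V) : View where
  root := ident v
  verts := {i | ∃ a, G.dist v a ≤ t ∧ ident a = i}
  edges := {e | ∃ a b, G.dist v a ≤ t ∧ G.dist v b ≤ t ∧ G.Adj a b ∧ e = s(ident a, ident b)}

/-- A deterministic local algorithm: a function of the size `n` of the graph and of the
neighbourhood of a vertex `v`, whose value gives a label to every half-edge at `v`. The real
half-edge towards a neighbour is referred to by the identifier of this neighbour (`Sum.inl`), the
virtual half-edges are referred to by their index (`Sum.inr`). -/
abbrev LocalAlgorithm (Λ : Type*) : Type _ := ℕ → View → ℕ ⊕ ℕ → Λ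

/-- The half-edge labeling produced by the algorithm `A` with local complexity `t`. -/
def LocalAlgorithm.run {Λ : Type*} (A : LocalAlgorithm Λ) (t : ℕ → ℕ) (Δ : ℕ)
    {V : Type*} [Fintype V] (G : SimpleGraph V) [DecidableRel G.Adj] (ident : V → ℕ) :
    HalfEdgeLabeling Δ G Λ :=
  fun v h =>
    A (Fintype.card V) (viewAt G ident (t (Fintype.card V)) v)
      (Sum.map (fun w : G.neighborSet v => ident w) (fun i : Fin (Δ - G.degree v) => (i : ℕ)) h)

/-- `P` has deterministic local complexity `t` on finite `Δ`-regular trees: for some constant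
`C ≥ 1`, some local algorithm of local complexity `t` returns a correct solution on every finite
`Δ`-regular tree with `n` vertices, for every assignment of distinct identifiers from
`{1, …, n ^ C}`. -/
def HasLocalComplexity {Δ : ℕ} {Λ : Type*} (P : LCL Δ Λ) (t : ℕ → ℕ) : Prop :=
  ∃ C : ℕ, 1 ≤ C ∧ ∃ A : LocalAlgorithm Λ,
    ∀ (V : Type) [Fintype V] (G : SimpleGraph V) [DecidableRel G.Adj],
      IsRegularTree Δ G →
      ∀ ident : V → ℕ, Function.Injective ident →
        (∀ v, ident v ∈ Finset.Icc 1 (Fintype.card V ^ C)) →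
        IsSolution P (A.run t Δ G ident)

/-- `t(n) = n ^ o(1)`: for every `ε > 0`, `t(n) ≤ n ^ ε` for all sufficiently large `n`. -/
def IsSubpolynomial (t : ℕ → ℕ) : Prop :=
  ∀ ε : ℝ, 0 < ε → ∀ᶠ n : ℕ in Filter.atTop, (t n : ℝ) ≤ (n : ℝ) ^ ε

/-- The class `LOCAL(n ^ o(1))` (deterministic). -/
def InLocalSubpolynomial {Δ : ℕ} {Λ : Type*} (P : LCL Δ Λ) : Prop :=
  ∃ t : ℕ → ℕ, IsSubpolynomial t ∧ HasLocalComplexity P t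

end Local

instance pathGraphDecidableAdj (k : ℕ) : DecidableRel (SimpleGraph.pathGraph k).Adj :=
  fun _ _ => decidable_of_iff _ SimpleGraph.pathGraph_adj.symm

/-- `S` is an `ℓ`-full set of vertex configurations of `P` (for `ℓ ≥ 2`). The path has
`m + 2 ≥ ℓ` vertices `0, …, m + 1`; each of them gets half-edges up to degree `Δ`. Of the
labeling `c₀` only the part around the two endpoints is used: it is an arbitrary labeling of
their half-edges with configurations from `S`. -/
def IsFull {Δ : ℕ} {Λ : Type*} (P : LCL Δ Λ) (S : Set (Multiset Λ)) (ℓ : ℕ) : Prop :=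
  S ⊆ P.vertexConfigs ∧
    ∀ m : ℕ, ℓ ≤ m + 2 →
      ∀ c₀ : HalfEdgeLabeling Δ (SimpleGraph.pathGraph (m + 2)) Λ,
        configAt c₀ 0 ∈ S → configAt c₀ (Fin.last (m + 1)) ∈ S →
        ∃ c : HalfEdgeLabeling Δ (SimpleGraph.pathGraph (m + 2)) Λ,
          c 0 = c₀ 0 ∧ c (Fin.last (m + 1)) = c₀ (Fin.last (m + 1)) ∧
          (∀ v, configAt c v ∈ S) ∧
          ∀ (u v : Fin (m + 2)) (h : (SimpleGraph.pathGraph (m + 2)).Adj u v),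
            edgeConfig c h ∈ P.edgeConfigs

end RegTreeLCL

/-! Finite pieces of the infinite properly `Δ`-edge-coloured tree serve as inputs, and the vertex
configurations that the algorithm outputs at well-surrounded vertices of pieces with at most `N`
vertices are collected. Being well-surrounded has levels: at level `i + 1` all two-coloured paths
leaving the vertex start out within a piece whose vertices are well-surrounded at level `i`. Two
configurations of level `i + 1` can therefore be joined by a long path of vertices of level `i` in
a larger piece. The identifiers around the two ends may clash, but the output in the middle of the
path depends on neither end, so two assignments, one for each end, can be combined there.

Lowering the level and raising `N` step by step gives an increasing chain of non-empty subsets of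
the finite set `𝒱`, so two consecutive ones coincide; the common set is full. The sizes involved
are polynomial in the radius `t(n)`, hence smaller than `n` for some `n`, and a piece with fewer
than `n` vertices can be padded to exactly `n` vertices out of sight of the chosen vertices. -/

namespace RegTreeLCL

section Identifiers

variable {X : Type*} {n : ℕ}

/-- Distinct identifiers from `{1, …, n}` for the vertices in `U`, extended by junk outside `U`. -/
def IsIdentOn (n : ℕ) (U : Finset X) (f : X → ℕ) : Prop :=
  Set.InjOn f U ∧ Set.MapsTo f U (Set.Icc 1 n)

theorem IsIdentOn.mono {A B : Finset X} {f : X → ℕ} (hf : IsIdentOn n B f) (h : A ⊆ B) :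
    IsIdentOn n A f :=
  ⟨hf.1.mono (Finset.coe_subset.2 h), hf.2.mono_left (Finset.coe_subset.2 h)⟩

theorem IsIdentOn.congr {A : Finset X} {f g : X → ℕ} (hf : IsIdentOn n A f)
    (h : Set.EqOn f g A) : IsIdentOn n A g :=
  ⟨hf.1.congr h, hf.2.congr h⟩

theorem IsIdentOn.card_le {A : Finset X} {f : X → ℕ} (hf : IsIdentOn n A f) : A.card ≤ n := by
  simpa only [Nat.card_Icc, Nat.add_sub_cancel] using
    Finset.card_le_card_of_injOn f (fun _ hx => Finset.mem_Icc.2 (hf.2 hx)) hf.1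

theorem isIdentOn_union [DecidableEq X] {A B : Finset X} (hAB : Disjoint A B) {f : X → ℕ} :
    IsIdentOn n (A ∪ B) f ↔
      IsIdentOn n A f ∧ IsIdentOn n B f ∧ Disjoint (A.image f) (B.image f) := by
  have h : (∀ a ∈ (A : Set X), ∀ b ∈ (B : Set X), f a ≠ f b) ↔
      Disjoint (A.image f) (B.image f) := by
    simp only [Finset.disjoint_left, Finset.mem_image, Finset.mem_coe]
    grind
  rw [IsIdentOn, Finset.coe_union, Set.injOn_union (Finset.disjoint_coe.2 hAB), h,
    Set.mapsTo_union, IsIdentOn, IsIdentOn]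
  tauto

theorem exists_isIdentOn_avoiding {D : Finset X} {F : Finset ℕ} (h : D.card + F.card ≤ n) :
    ∃ f : X → ℕ, IsIdentOn n D f ∧ ∀ x ∈ D, f x ∉ F := by
  have hF := Finset.le_card_sdiff F (Finset.Icc 1 n)
  rw [Nat.card_Icc] at hF
  obtain ⟨f, hf, hinj⟩ := D.finite_toSet.exists_injOn_of_encard_le
    (t := ((Finset.Icc 1 n \ F : Finset ℕ) : Set ℕ)) (by
      rw [Set.encard_coe_eq_coe_finsetCard, Set.encard_coe_eq_coe_finsetCard]
      exact_mod_cast (by omega))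
  have hf' : ∀ x ∈ D, f x ∈ Finset.Icc 1 n ∧ f x ∉ F := fun x hx =>
    Finset.mem_sdiff.1 (hf hx)
  exact ⟨f, ⟨hinj, fun x hx => Finset.mem_Icc.1 (hf' x hx).1⟩, fun x hx => (hf' x hx).2⟩

theorem IsIdentOn.exists_extension {A B : Finset X} {f : X → ℕ}
    (hf : IsIdentOn n A f) (hAB : A ⊆ B) {F : Finset ℕ} (hn : B.card + F.card ≤ n) :
    ∃ g, Set.EqOn g f A ∧ IsIdentOn n B g ∧ ∀ x ∈ B, x ∉ A → g x ∉ F := by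
  classical
  have hcard := Finset.card_sdiff_add_card_eq_card hAB
  have himage := Finset.card_image_le (s := A) (f := f)
  obtain ⟨d, hd, hdF⟩ := exists_isIdentOn_avoiding (n := n) (D := B \ A) (F := A.image f ∪ F)
    ((Nat.add_le_add_left (Finset.card_union_le _ _) _).trans (by omega))
  have hA : Set.EqOn (A.piecewise f d) f A := fun _ hx =>
    A.piecewise_eq_of_mem f d hx
  have hd' : Set.EqOn (A.piecewise f d) d ↑(B \ A) := fun x hx =>
    A.piecewise_eq_of_notMem f d (Finset.mem_sdiff.1 hx).2
  refine ⟨A.piecewise f d, hA, ?_, fun x hx hxA => ?_⟩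
  · rw [← Finset.union_sdiff_of_subset hAB, isIdentOn_union Finset.disjoint_sdiff]
    refine ⟨hf.congr hA.symm, hd.congr hd'.symm, ?_⟩
    rw [Finset.image_congr hA, Finset.image_congr hd', Finset.disjoint_right]
    intro y hy hyA
    obtain ⟨x, hx, rfl⟩ := Finset.mem_image.1 hy
    exact hdF x hx (Finset.mem_union_left _ hyA)
  · have hx' := Finset.mem_sdiff.2 ⟨hx, hxA⟩
    rw [hd' hx']
    exact fun h => hdF x hx' (Finset.mem_union_right _ h)

theorem exists_extension_pair {A B U : Finset X} (hA : A ⊆ U) (hB : B ⊆ U)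
    {f g : X → ℕ} (hf : IsIdentOn n A f) (hg : IsIdentOn n B g) (hn : U.card + B.card ≤ n) :
    ∃ f' g', Set.EqOn f' f A ∧ Set.EqOn g' g B ∧ IsIdentOn n U f' ∧ IsIdentOn n U g' ∧
      ∀ x ∈ U, x ∉ A → x ∉ B → f' x = g' x := by
  classical
  obtain ⟨f', hf'f, hf', havoid⟩ := hf.exists_extension hA (F := B.image g)
    ((Nat.add_le_add_left Finset.card_image_le _).trans hn)
  have hBD : Disjoint B (U \ (A ∪ B)) :=
    Finset.disjoint_sdiff.mono_left Finset.subset_union_right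
  have hD : ∀ x ∈ U \ (A ∪ B), x ∈ U ∧ x ∉ A ∧ x ∉ B := by simp
  have hpB : Set.EqOn (B.piecewise g f') g B := fun _ hx =>
    B.piecewise_eq_of_mem g f' hx
  have hpD : Set.EqOn (B.piecewise g f') f' ↑(U \ (A ∪ B)) := fun x hx =>
    B.piecewise_eq_of_notMem g f' (hD x hx).2.2
  have hp : IsIdentOn n (B ∪ U \ (A ∪ B)) (B.piecewise g f') := by
    rw [isIdentOn_union hBD, Finset.image_congr hpB, Finset.image_congr hpD,
      Finset.disjoint_right]
    refine ⟨hg.congr hpB.symm, (hf'.mono fun x hx => (hD x hx).1).congr hpD.symm, fun y hy => ?_⟩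
    obtain ⟨x, hx, rfl⟩ := Finset.mem_image.1 hy
    exact havoid x (hD x hx).1 (hD x hx).2.1
  obtain ⟨g', hg'p, hg', -⟩ := hp.exists_extension (F := ∅)
    (Finset.union_subset hB fun x hx => (hD x hx).1) (by simp; omega)
  refine ⟨f', g', hf'f, fun x hx => ?_, hf', hg', fun x hxU hxA hxB => ?_⟩
  · rw [hg'p (Finset.mem_union_left _ hx), hpB hx]
  · have hx : x ∈ U \ (A ∪ B) := by simp [hxU, hxA, hxB]
    rw [hg'p (Finset.mem_union_right _ hx), hpD hx]

end Identifiers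

section Links

variable {Δ : ℕ} {Λ : Type*} {P : LCL Δ Λ} {S : Set (Multiset Λ)}

/-- The labels `x` and `y` may stand on two different half-edges of a vertex with a configuration
from `S`. -/
def Joint (S : Set (Multiset Λ)) (x y : Λ) : Prop := ∃ c ∈ S, x ::ₘ y ::ₘ 0 ≤ c

/-- Half-edges with labels `a` and `b` can be joined by a path with `m` inner vertices whose
configurations are in `S`. -/
def Linkable (P : LCL Δ Λ) (S : Set (Multiset Λ)) : ℕ → Λ → Λ → Prop
  | 0, a, b => s(a, b) ∈ P.edgeConfigs
  | m + 1, a, b => ∃ x y, s(a, x) ∈ P.edgeConfigs ∧ Joint S x y ∧ Linkable P S m y b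

/-- Any two half-edges at vertices with configurations from `S` can be joined by a path with `m`
inner vertices whose configurations are in `S`: fullness at the length `m + 2`. -/
def AllLinkable (P : LCL Δ Λ) (S : Set (Multiset Λ)) (m : ℕ) : Prop :=
  ∀ c₁ ∈ S, ∀ c₂ ∈ S, ∀ a ∈ c₁, ∀ b ∈ c₂, Linkable P S m a b

theorem Linkable.trans {m m' : ℕ} {a x y b : Λ} (h : Linkable P S m a x) (hxy : Joint S x y)
    (h' : Linkable P S m' y b) : Linkable P S (m + m' + 1) a b := by
  induction m generalizing a with
  | zero => rw [zero_add]; exact ⟨x, y, h, hxy, h'⟩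
  | succ m ih =>
    obtain ⟨u, w, hau, huw, hwx⟩ := h
    rw [show m + 1 + m' + 1 = (m + m' + 1) + 1 by ring]
    exact ⟨u, w, hau, huw, ih hwx⟩

theorem Linkable.exists_seq {m : ℕ} {a b : Λ} (h : Linkable P S m a b) :
    ∃ l r : ℕ → Λ, r 0 = a ∧ l (m + 1) = b ∧ (∀ j, 1 ≤ j → j ≤ m → Joint S (l j) (r j)) ∧
      ∀ j ≤ m, s(r j, l (j + 1)) ∈ P.edgeConfigs := by
  induction m generalizing a with
  | zero => exact ⟨fun _ => b, fun _ => a, rfl, rfl, fun j h1 h2 => by omega, fun j _ => h⟩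
  | succ m ih =>
    obtain ⟨x, y, hax, hxy, hyb⟩ := h
    obtain ⟨l, r, rfl, rfl, hj, he⟩ := ih hyb
    refine ⟨fun j => if j = 1 then x else l (j - 1), fun j => if j = 0 then a else r (j - 1),
      rfl, by simp, ?_, ?_⟩
    · rintro (_ | _ | j) h1 h2
      · omega
      · simpa using hxy
      · simpa using hj (j + 1) (by omega) (by omega)
    · rintro (_ | j) hj
      · simpa using hax
      · simpa using he j (by omega)

theorem exists_joint_of_two_le (hΔ : 2 ≤ Δ) (hS : S ⊆ P.vertexConfigs) (hne : S.Nonempty) :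
    ∃ c ∈ S, ∃ x ∈ c, ∃ y ∈ c, Joint S x y := by
  obtain ⟨c, hc⟩ := hne
  obtain ⟨k, rfl⟩ := Nat.exists_eq_add_of_le' hΔ
  obtain ⟨x, d, rfl, hd⟩ := Multiset.card_eq_succ_iff.1 (P.card_of_mem c (hS hc))
  obtain ⟨y, d, rfl, -⟩ := Multiset.card_eq_succ_iff.1 hd
  exact ⟨_, hc, x, by simp, y, by simp, _, hc,
    Multiset.cons_le_cons _ (Multiset.cons_le_cons _ (Multiset.zero_le _))⟩

theorem AllLinkable.add (hΔ : 2 ≤ Δ) (hS : S ⊆ P.vertexConfigs) {m m' : ℕ}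
    (h : AllLinkable P S m) (h' : AllLinkable P S m') : AllLinkable P S (m + m' + 1) := by
  intro c₁ hc₁ c₂ hc₂ a ha b hb
  obtain ⟨c, hc, x, hx, y, hy, hxy⟩ := exists_joint_of_two_le hΔ hS ⟨c₁, hc₁⟩
  exact (h c₁ hc₁ c hc a ha x hx).trans hxy (h' c hc c₂ hc₂ y hy b hb)

theorem allLinkable_of_le (hΔ : 2 ≤ Δ) (hS : S ⊆ P.vertexConfigs) {M : ℕ}
    (h : ∀ m, M ≤ m → m ≤ 2 * M → AllLinkable P S m) (m : ℕ) (hm : M ≤ m) :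
    AllLinkable P S m := by
  induction m using Nat.strong_induction_on with
  | _ m ih =>
    rcases le_or_gt m (2 * M) with hle | hlt
    · exact h m hm hle
    · rw [show m = M + (m - M - 1) + 1 by omega]
      exact (h M le_rfl (by omega)).add hΔ hS (ih _ (by omega) (by omega))

end Links

section Paths

variable {Δ : ℕ} {Λ : Type*}

theorem exists_map_val_eq {ι : Type*} (s : Finset ι) {c : Multiset Λ} [Nonempty Λ]
    (h : Multiset.card c = s.card) : ∃ f : ι → Λ, s.val.map f = c := by
  classical
  induction s using Finset.induction_on generalizing c with
  | empty => exact ⟨fun _ => Classical.arbitrary Λ, by simpa [eq_comm] using h⟩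
  | insert i s hi ih =>
    rw [Finset.card_insert_of_notMem hi] at h
    obtain ⟨b, c, rfl, hc⟩ := Multiset.card_eq_succ_iff.1 h
    obtain ⟨f, rfl⟩ := ih hc
    refine ⟨Function.update f i b, ?_⟩
    rw [Finset.insert_val_of_notMem hi, Multiset.map_cons, Function.update_self]
    congr 1
    exact Multiset.map_congr rfl fun j hj =>
      Function.update_of_ne (ne_of_mem_of_not_mem (Finset.mem_def.2 hj) hi) _ _

theorem exists_map_univ_val_eq {ι : Type*} [Fintype ι] {p q : ι} (hpq : p ≠ q) {x y : Λ}
    {c : Multiset Λ} (hc : Multiset.card c = Fintype.card ι) (hxy : x ::ₘ y ::ₘ 0 ≤ c) :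
    ∃ f : ι → Λ, (Finset.univ : Finset ι).val.map f = c ∧ f p = x ∧ f q = y := by
  classical
  obtain ⟨rest, rfl⟩ := Multiset.le_iff_exists_add.1 hxy
  have : Nonempty Λ := ⟨x⟩
  let s : Finset ι := {p, q}ᶜ
  have hp : p ∉ insert q s := by simp [s, hpq]
  have hq : q ∉ s := by simp [s]
  have huniv : Finset.univ = insert p (insert q s) := by ext i; simp [s]; tauto
  obtain ⟨g, rfl⟩ := exists_map_val_eq s (c := rest) (by
    rw [← Finset.card_univ, huniv, Finset.card_insert_of_notMem hp,
      Finset.card_insert_of_notMem hq] at hc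
    simp only [Multiset.card_add, Multiset.card_cons, Multiset.card_zero] at hc
    omega)
  refine ⟨fun i => if i = p then x else if i = q then y else g i, ?_, by simp, by simp [hpq.symm]⟩
  rw [huniv, Finset.insert_val_of_notMem hp, Finset.insert_val_of_notMem hq, Multiset.map_cons,
    Multiset.map_cons]
  have hg : s.val.map (fun i => if i = p then x else if i = q then y else g i) = s.val.map g :=
    Multiset.map_congr rfl fun i hi => by
      have : i ≠ p ∧ i ≠ q := by simpa [s] using (Finset.mem_def.2 hi : i ∈ s)
      simp [this]
  simp [hg, hpq.symm]

theorem eq_of_pathGraph_adj_of_lt_iff_lt {k : ℕ} {v w w' : Fin k}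
    (h : (SimpleGraph.pathGraph k).Adj v w) (h' : (SimpleGraph.pathGraph k).Adj v w')
    (hlt : v < w ↔ v < w') : w = w' := by
  rw [SimpleGraph.pathGraph_adj] at h h'
  rw [Fin.lt_def, Fin.lt_def] at hlt
  exact Fin.ext (by omega)

theorem degree_pathGraph_le {k : ℕ} (v : Fin k) : (SimpleGraph.pathGraph k).degree v ≤ 2 := by
  rw [← SimpleGraph.card_neighborSet_eq_degree, ← Fintype.card_bool]
  refine Fintype.card_le_of_injective (fun w => decide (v < w.1)) fun w w' h => Subtype.ext ?_
  exact eq_of_pathGraph_adj_of_lt_iff_lt w.2 w'.2 (by simpa using h)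

/-- The labels `f` around the vertex `v` of a path are `x` on the half-edge towards the preceding
vertex and `y` on the half-edge towards the following one, where these exist. -/
def HasSideLabels {k : ℕ} {v : Fin k} (f : HalfEdgeAt Δ (SimpleGraph.pathGraph k) v → Λ)
    (x y : Λ) : Prop :=
  (∀ w, w.1 < v → f (Sum.inl w) = x) ∧ ∀ w, v < w.1 → f (Sum.inl w) = y

theorem exists_labels_of_inner_vertex (hΔ : 2 ≤ Δ) {m : ℕ} {v : Fin (m + 2)} (h0 : v ≠ 0)
    (hlast : v ≠ Fin.last (m + 1)) {c : Multiset Λ} (hc : Multiset.card c = Δ) {x y : Λ}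
    (hxy : x ::ₘ y ::ₘ 0 ≤ c) :
    ∃ f : HalfEdgeAt Δ (SimpleGraph.pathGraph (m + 2)) v → Λ,
      (Finset.univ : Finset (HalfEdgeAt Δ (SimpleGraph.pathGraph (m + 2)) v)).val.map f = c ∧
      HasSideLabels f x y := by
  have hv0 : v.1 ≠ 0 := fun h => h0 (Fin.ext h)
  have hvlast : v.1 ≠ m + 1 := fun h => hlast (Fin.ext h)
  have hv := v.2
  let p : (SimpleGraph.pathGraph (m + 2)).neighborSet v :=
    ⟨⟨v - 1, by omega⟩, SimpleGraph.pathGraph_adj.2 (Or.inr (by dsimp only; omega))⟩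
  let q : (SimpleGraph.pathGraph (m + 2)).neighborSet v :=
    ⟨⟨v + 1, by omega⟩, SimpleGraph.pathGraph_adj.2 (Or.inl rfl)⟩
  have hpv : p.1 < v := Fin.lt_def.2 (by dsimp only [p]; omega)
  have hvq : v < q.1 := Fin.lt_def.2 (by dsimp only [q]; omega)
  have hpq : (Sum.inl p : HalfEdgeAt Δ (SimpleGraph.pathGraph (m + 2)) v) ≠ Sum.inl q :=
    fun h => (hpv.trans hvq).ne (congrArg Subtype.val (Sum.inl.inj h))
  have hcard : Multiset.card c =
      Fintype.card (HalfEdgeAt Δ (SimpleGraph.pathGraph (m + 2)) v) := by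
    have := degree_pathGraph_le v
    rw [Fintype.card_sum, SimpleGraph.card_neighborSet_eq_degree, Fintype.card_fin, hc]
    omega
  obtain ⟨f, hf, hfp, hfq⟩ := exists_map_univ_val_eq hpq hcard hxy
  refine ⟨f, hf, fun w hw => ?_, fun w hw => ?_⟩
  · rw [← hfp, Subtype.ext (eq_of_pathGraph_adj_of_lt_iff_lt w.2 p.2
      (iff_of_false hw.not_gt hpv.not_gt))]
  · rw [← hfq, Subtype.ext (eq_of_pathGraph_adj_of_lt_iff_lt w.2 q.2 (iff_of_true hw hvq))]

variable {P : LCL Δ Λ} {S : Set (Multiset Λ)}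

theorem edgeConfig_mem_of_hasSideLabels {k : ℕ} {c : HalfEdgeLabeling Δ (SimpleGraph.pathGraph k) Λ}
    {l r : ℕ → Λ} (hc : ∀ v, HasSideLabels (c v) (l v) (r v))
    (he : ∀ j, j + 1 < k → s(r j, l (j + 1)) ∈ P.edgeConfigs)
    (u v : Fin k) (h : (SimpleGraph.pathGraph k).Adj u v) : edgeConfig c h ∈ P.edgeConfigs := by
  wlog huv : u.1 + 1 = v.1 generalizing u v
  · have hvu := this v u h.symm ((SimpleGraph.pathGraph_adj.1 h).resolve_left huv)
    rwa [edgeConfig, Sym2.eq_swap] at hvu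
  have hlt : u < v := Fin.lt_def.2 (by omega)
  rw [edgeConfig, (hc u).2 ⟨v, h⟩ hlt, (hc v).1 ⟨u, h.symm⟩ hlt, ← huv]
  exact he u (huv ▸ v.2)

theorem exists_labeling_of_joints (hΔ : 2 ≤ Δ) (hS : S ⊆ P.vertexConfigs) {m : ℕ}
    {c₀ : HalfEdgeLabeling Δ (SimpleGraph.pathGraph (m + 2)) Λ} {l r : ℕ → Λ}
    (h₀ : configAt c₀ 0 ∈ S) (hside₀ : HasSideLabels (c₀ 0) (l 0) (r 0))
    (hlast : configAt c₀ (Fin.last (m + 1)) ∈ S)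
    (hside_last : HasSideLabels (c₀ (Fin.last (m + 1))) (l (m + 1)) (r (m + 1)))
    (hj : ∀ j, 1 ≤ j → j ≤ m → Joint S (l j) (r j)) :
    ∃ c : HalfEdgeLabeling Δ (SimpleGraph.pathGraph (m + 2)) Λ,
      c 0 = c₀ 0 ∧ c (Fin.last (m + 1)) = c₀ (Fin.last (m + 1)) ∧
      (∀ v, configAt c v ∈ S) ∧ ∀ v, HasSideLabels (c v) (l v) (r v) := by
  have hlabels : ∀ v : Fin (m + 2), ∃ f : HalfEdgeAt Δ (SimpleGraph.pathGraph (m + 2)) v → Λ,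
      (v = 0 → f = c₀ v) ∧ (v = Fin.last (m + 1) → f = c₀ v) ∧
      (Finset.univ : Finset (HalfEdgeAt Δ (SimpleGraph.pathGraph (m + 2)) v)).val.map f ∈ S ∧
      HasSideLabels f (l v) (r v) := by
    intro v
    rcases eq_or_ne v 0 with rfl | hv0
    · exact ⟨c₀ 0, fun _ => rfl, fun _ => rfl, h₀, hside₀⟩
    rcases eq_or_ne v (Fin.last (m + 1)) with rfl | hvlast
    · exact ⟨c₀ _, fun _ => rfl, fun _ => rfl, hlast, hside_last⟩
    obtain ⟨c, hcS, hc⟩ := hj v (Nat.one_le_iff_ne_zero.2 (Fin.val_ne_zero_iff.2 hv0))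
      (Nat.lt_succ_iff.1 (Fin.val_lt_last hvlast))
    obtain ⟨f, hf, hside⟩ :=
      exists_labels_of_inner_vertex hΔ hv0 hvlast (P.card_of_mem c (hS hcS)) hc
    exact ⟨f, fun h => absurd h hv0, fun h => absurd h hvlast, hf ▸ hcS, hside⟩
  choose c hc₀ hclast hcS hside using hlabels
  exact ⟨c, hc₀ 0 rfl, hclast _ rfl, hcS, hside⟩

theorem isFull_of_allLinkable (hΔ : 2 ≤ Δ) (hS : S ⊆ P.vertexConfigs) {ℓ : ℕ}
    (h : ∀ m, ℓ ≤ m + 2 → AllLinkable P S m) : IsFull P S ℓ := by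
  refine ⟨hS, fun m hm c₀ h₀ hlast => ?_⟩
  have hadj : (SimpleGraph.pathGraph (m + 2)).Adj 0 1 := SimpleGraph.pathGraph_adj.2 (Or.inl rfl)
  have hadj' : (SimpleGraph.pathGraph (m + 2)).Adj (Fin.last (m + 1)) ⟨m, by omega⟩ :=
    SimpleGraph.pathGraph_adj.2 (Or.inr rfl)
  obtain ⟨l, r, hr, hl, hj, he⟩ := (h m hm _ h₀ _ hlast (c₀ 0 (Sum.inl ⟨1, hadj⟩))
    (Multiset.mem_map_of_mem _ (Finset.mem_univ_val _))
    (c₀ (Fin.last (m + 1)) (Sum.inl ⟨⟨m, by omega⟩, hadj'⟩))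
    (Multiset.mem_map_of_mem _ (Finset.mem_univ_val _))).exists_seq
  have hside₀ : HasSideLabels (c₀ 0) (l 0) (r 0) := by
    refine ⟨fun w hw => absurd hw (Fin.not_lt_zero _), fun w hw => ?_⟩
    obtain rfl : w = ⟨1, hadj⟩ := Subtype.ext (eq_of_pathGraph_adj_of_lt_iff_lt w.2 hadj
      (iff_of_true hw (Fin.lt_def.2 Nat.one_pos)))
    exact hr.symm
  have hside_last : HasSideLabels (c₀ (Fin.last (m + 1))) (l (m + 1)) (r (m + 1)) := by
    refine ⟨fun w hw => ?_, fun w hw => absurd hw (Fin.le_last _).not_gt⟩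
    obtain rfl : w = ⟨_, hadj'⟩ := Subtype.ext (eq_of_pathGraph_adj_of_lt_iff_lt w.2 hadj'
      (iff_of_false hw.not_gt (Fin.le_last _).not_gt))
    exact hl.symm
  obtain ⟨c, hc₀, hclast, hcS, hside⟩ :=
    exists_labeling_of_joints hΔ hS h₀ hside₀ hlast hside_last hj
  exact ⟨c, hc₀, hclast, hcS, edgeConfig_mem_of_hasSideLabels hside fun j hj => he j (by omega)⟩

theorem finite_vertexConfigs [Finite Λ] (P : LCL Δ Λ) : P.vertexConfigs.Finite := by
  have := Fintype.ofFinite Λ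
  classical
  exact (Set.finite_range fun s : Sym Λ Δ => (s : Multiset Λ)).subset fun c hc =>
    ⟨⟨c, P.card_of_mem c hc⟩, rfl⟩

end Paths

section InducedSubgraphs

variable {V : Type*} {G : SimpleGraph V}

theorem dist_iso_apply {W : Type*} {H : SimpleGraph W} (hG : G.Connected) (hH : H.Connected)
    (φ : G ≃g H) (x y : V) : H.dist (φ x) (φ y) = G.dist x y := by
  refine le_antisymm ?_ ?_
  · obtain ⟨p, hp⟩ := hG.exists_walk_length_eq_dist x y
    rw [← hp, ← SimpleGraph.Walk.length_map φ.toHom p]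
    exact SimpleGraph.dist_le _
  · obtain ⟨p, hp⟩ := hH.exists_walk_length_eq_dist (φ x) (φ y)
    rw [← hp, ← SimpleGraph.Walk.length_map φ.symm.toHom p]
    simpa using SimpleGraph.dist_le (p.map φ.symm.toHom)

theorem dist_induce_of_isTree (hG : G.IsTree) {U : Set V} (hU : (G.induce U).Connected)
    (a b : U) : (G.induce U).dist a b = G.dist a b := by
  obtain ⟨p, hp, hpdist⟩ := hU.exists_path_of_dist a b
  obtain ⟨q, hq, hqdist⟩ := hG.1.exists_path_of_dist a b
  have hinj : Function.Injective (SimpleGraph.Embedding.induce (G := G) U).toHom :=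
    (SimpleGraph.Embedding.induce (G := G) U).injective
  have hpq := (hG.2.subsingleton_path (a : V) b).elim ⟨_, hp.map hinj⟩ ⟨q, hq⟩
  have hlen := congrArg (fun r : G.Path (a : V) b => r.1.length) hpq
  rw [← hpdist, ← hqdist, ← hlen]
  exact (SimpleGraph.Walk.length_map _ p).symm

theorem dist_le_card_of_isTree (hG : G.IsTree) {U : Finset V}
    (hU : (G.induce (U : Set V)).Connected) {a b : V} (ha : a ∈ U) (hb : b ∈ U) :
    G.dist a b ≤ U.card := by
  obtain ⟨p, hp, hpdist⟩ := hU.exists_path_of_dist ⟨a, ha⟩ ⟨b, hb⟩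
  rw [← dist_induce_of_isTree hG hU ⟨a, ha⟩ ⟨b, hb⟩, ← hpdist]
  simpa using hp.length_lt.le

theorem connected_induce_iUnion_le {w : ℕ → V} {s : ℕ → Set V} {m : ℕ}
    (hs : ∀ j ≤ m, (G.induce (s j)).Connected) (hw : ∀ j ≤ m, w j ∈ s j)
    (hadj : ∀ j < m, G.Adj (w j) (w (j + 1))) : (G.induce (⋃ j ≤ m, s j)).Connected := by
  induction m with
  | zero =>
    have hunion : ⋃ j ≤ 0, s j = s 0 := by
      simp only [Nat.le_zero, Set.iUnion_iUnion_eq_left]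
    rw [hunion]
    exact hs 0 le_rfl
  | succ m ih =>
    rw [Set.biUnion_le_succ]
    exact SimpleGraph.connected_induce_union
      (ih (fun j hj => hs j (by omega)) (fun j hj => hw j (by omega))
        (fun j hj => hadj j (by omega))).preconnected
      (hs (m + 1) le_rfl).preconnected (Set.mem_biUnion (Set.mem_Iic.2 le_rfl) (hw m (by omega)))
      (hw (m + 1) le_rfl) (hadj m (by omega))

end InducedSubgraphs

/-- Words without two equal consecutive letters: the vertices of the infinite tree with a proper
edge colouring in which every vertex has one edge of each colour `α : ι`. The last traversed edge
is the head of the word. -/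
abbrev Word (ι : Type*) : Type _ := {w : List ι // w.IsChain (· ≠ ·)}

namespace Word

variable {ι : Type*}

/-- The root of the tree. -/
def nil : Word ι := ⟨[], List.isChain_nil⟩

/-- The depth of a vertex. -/
def len (x : Word ι) : ℕ := x.1.length

theorem exists_head_ne [Nontrivial ι] (x : Word ι) : ∃ α, x.1.head? ≠ some α := by
  by_contra! h
  obtain ⟨α, β, hαβ⟩ := exists_pair_ne ι
  exact hαβ (Option.some.inj ((h α).symm.trans (h β)))

/-- The colour sequence `α, β, α, β, …`. -/
def alternate (α β : ι) (j : ℕ) : ι := if Even j then α else β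

theorem alternate_ne {α β : ι} (h : α ≠ β) (j : ℕ) : alternate α β j ≠ alternate α β (j + 1) := by
  by_cases hj : Even j <;> simp [alternate, Nat.even_add_one, hj, h, h.symm]

theorem alternate_shift (α β : ι) (i j : ℕ) :
    alternate (alternate α β i) (alternate α β (i + 1)) j = alternate α β (i + j) := by
  by_cases hi : Even i <;> by_cases hj : Even j <;>
    simp [alternate, Nat.even_add_one, Nat.even_add, hi, hj]

theorem apply_alternate (π : Equiv.Perm ι) (α β : ι) (j : ℕ) :
    π (alternate α β j) = alternate (π α) (π β) j :=
  apply_ite π _ _ _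

variable [DecidableEq ι]

/-- The neighbour of `x` along the edge of colour `α`. -/
def step (α : ι) (x : Word ι) : Word ι :=
  if h : x.1.head? = some α then ⟨x.1.tail, x.2.tail⟩
  else ⟨α :: x.1, List.isChain_cons.2 ⟨fun _ hβ hαβ => h (hαβ ▸ hβ), x.2⟩⟩

theorem cons_step_of_head {α : ι} {x : Word ι} (h : x.1.head? = some α) :
    α :: (step α x).1 = x.1 := by
  rw [step, dif_pos h]
  exact List.cons_head?_tail h

theorem step_of_not_head {α : ι} {x : Word ι} (h : x.1.head? ≠ some α) :
    (step α x).1 = α :: x.1 := by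
  rw [step, dif_neg h]

theorem head_step_ne {α : ι} {x : Word ι} (h : x.1.head? = some α) :
    (step α x).1.head? ≠ some α := by
  have hx := x.2
  rw [← cons_step_of_head h] at hx
  exact fun h' => (List.isChain_cons.1 hx).1 α h' rfl

@[simp] theorem step_step (α : ι) (x : Word ι) : step α (step α x) = x := by
  by_cases h : x.1.head? = some α
  · exact Subtype.ext (by rw [step_of_not_head (head_step_ne h), cons_step_of_head h])
  · have hcons := step_of_not_head h
    refine Subtype.ext (List.cons_injective (a := α) ?_)
    rw [cons_step_of_head (by rw [hcons]; rfl), hcons]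

theorem len_step_of_not_head {α : ι} {x : Word ι} (h : x.1.head? ≠ some α) :
    (step α x).len = x.len + 1 := by
  rw [len, step_of_not_head h, List.length_cons, len]

theorem len_step_of_head {α : ι} {x : Word ι} (h : x.1.head? = some α) :
    (step α x).len + 1 = x.len := by
  rw [len, len, ← cons_step_of_head h, List.length_cons]

theorem len_step_le (α : ι) (x : Word ι) : (step α x).len ≤ x.len + 1 := by
  by_cases h : x.1.head? = some α
  · have := len_step_of_head h; omega
  · exact (len_step_of_not_head h).le

theorem step_ne (α : ι) (x : Word ι) : step α x ≠ x := by
  intro h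
  by_cases h' : x.1.head? = some α
  · have := len_step_of_head h'; rw [h] at this; omega
  · have := len_step_of_not_head h'; rw [h] at this; omega

theorem step_left_injective (x : Word ι) : Function.Injective fun α => step α x := by
  intro α β (h : step α x = step β x)
  have hlen : ∀ γ, x.1.head? = some γ ↔ (step γ x).len < x.len := fun γ => by
    by_cases hγ : x.1.head? = some γ
    · have := len_step_of_head hγ; exact iff_of_true hγ (by omega)
    · have := len_step_of_not_head hγ; exact iff_of_false hγ (by omega)
  have hhead : x.1.head? = some α ↔ x.1.head? = some β := by rw [hlen, hlen, h]
  by_cases hα : x.1.head? = some α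
  · exact Option.some.inj (hα.symm.trans (hhead.1 hα))
  · have hcons := congrArg Subtype.val h
    rw [step_of_not_head hα, step_of_not_head (mt hhead.2 hα)] at hcons
    exact (List.cons.inj hcons).1

theorem step_induction {p : Word ι → Prop} (h0 : p nil) (hs : ∀ α x, p x → p (step α x))
    (x : Word ι) : p x := by
  obtain ⟨l, hl⟩ := x
  induction l with
  | nil => exact h0
  | cons α l ih =>
    have hstep : (⟨α :: l, hl⟩ : Word ι) = step α ⟨l, hl.tail⟩ := Subtype.ext
      (step_of_not_head (x := ⟨l, hl.tail⟩) fun h => (List.isChain_cons.1 hl).1 α h rfl).symm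
    rw [hstep]
    exact hs _ _ (ih _)

/-- The infinite tree in which every vertex has one edge of each colour. -/
def tree (ι : Type*) [DecidableEq ι] : SimpleGraph (Word ι) where
  Adj x y := ∃ α, y = step α x
  symm := ⟨by rintro x y ⟨α, rfl⟩; exact ⟨α, (step_step α x).symm⟩⟩
  loopless := ⟨by rintro x ⟨α, h⟩; exact step_ne α x h.symm⟩

theorem adj_step (α : ι) (x : Word ι) : (tree ι).Adj x (step α x) := ⟨α, rfl⟩

theorem dist_step (α : ι) (x : Word ι) : (tree ι).dist x (step α x) = 1 :=
  SimpleGraph.dist_eq_one_iff_adj.2 (adj_step α x)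

theorem connected_tree : (tree ι).Connected := by
  have hroot : ∀ x : Word ι, (tree ι).Reachable nil x :=
    step_induction (SimpleGraph.Reachable.refl _) fun α x hx => hx.trans (adj_step α x).reachable
  exact (SimpleGraph.connected_iff_exists_forall_reachable _).2 ⟨nil, hroot⟩

theorem eq_cons_or_eq_cons_of_adj {x y : Word ι} (h : (tree ι).Adj x y) :
    (∃ α, y.1 = α :: x.1) ∨ ∃ α, x.1 = α :: y.1 := by
  obtain ⟨α, rfl⟩ := h
  by_cases h : x.1.head? = some α
  · exact Or.inr ⟨α, (cons_step_of_head h).symm⟩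
  · exact Or.inl ⟨α, step_of_not_head h⟩

theorem suffix_of_walk_deleteEdges {x y : Word ι} {α : ι} (hxy : y.1 = α :: x.1) {a b : Word ι}
    (p : ((tree ι).deleteEdges {s(x, y)}).Walk a b) (ha : y.1 <:+ a.1) : y.1 <:+ b.1 := by
  induction p with
  | nil => exact ha
  | @cons a c b hac p ih =>
    rw [SimpleGraph.deleteEdges_adj] at hac
    rcases eq_cons_or_eq_cons_of_adj hac.1 with ⟨β, hβ⟩ | ⟨β, hβ⟩
    · exact ih (hβ ▸ ha.trans (List.suffix_cons β _))
    · rcases List.suffix_cons_iff.1 (hβ ▸ ha) with hya | hyc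
      · obtain rfl : y = a := Subtype.ext (hya.trans hβ.symm)
        obtain rfl : x = c := Subtype.ext (List.cons.inj (hxy.symm.trans hβ)).2
        exact absurd (Sym2.eq_swap : s(y, x) = s(x, y)) hac.2
      · exact ih hyc

theorem isTree_tree : (tree ι).IsTree := by
  refine ⟨connected_tree, SimpleGraph.isAcyclic_iff_forall_adj_isBridge.2 fun x y hxy => ?_⟩
  have hcut : ∀ {x y : Word ι} {α}, y.1 = α :: x.1 →
      ¬ ((tree ι).deleteEdges {s(x, y)}).Reachable y x := by
    rintro x y α h ⟨p⟩
    have := (suffix_of_walk_deleteEdges h p List.suffix_rfl).length_le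
    rw [h, List.length_cons] at this
    omega
  rw [SimpleGraph.isBridge_iff]
  rcases eq_cons_or_eq_cons_of_adj hxy with ⟨α, h⟩ | ⟨α, h⟩
  · exact fun hr => hcut h hr.symm
  · rw [Sym2.eq_swap]
    exact hcut h

theorem len_le_add_dist (x y : Word ι) : y.len ≤ x.len + (tree ι).dist x y := by
  obtain ⟨p, hp⟩ := connected_tree.exists_walk_length_eq_dist x y
  rw [← hp]
  clear hp
  induction p with
  | nil => simp
  | @cons a b c hab p ih =>
    have hb : b.len ≤ a.len + 1 := by
      obtain ⟨α, rfl⟩ := hab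
      exact len_step_le α a
    rw [SimpleGraph.Walk.length_cons]
    omega

/-- The automorphism `φ` of the tree acts on the colours of the edges as the permutation `π`. -/
def PermutesColors (φ : tree ι ≃g tree ι) (π : Equiv.Perm ι) : Prop :=
  ∀ α x, φ (step α x) = step (π α) (φ x)

theorem dist_apply (φ : tree ι ≃g tree ι) (x y : Word ι) :
    (tree ι).dist (φ x) (φ y) = (tree ι).dist x y :=
  dist_iso_apply connected_tree connected_tree φ x y

/-- The map of the tree that sends the root to `g` and acts on the colours as `π`. -/
def place (π : Equiv.Perm ι) (g x : Word ι) : Word ι := x.1.foldr (fun α => step (π α)) g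

theorem place_step (π : Equiv.Perm ι) (g : Word ι) (α : ι) (x : Word ι) :
    place π g (step α x) = step (π α) (place π g x) := by
  have hcons : ∀ {y z : Word ι}, z.1 = α :: y.1 → place π g z = step (π α) (place π g y) :=
    fun h => by rw [place, h, List.foldr_cons, place]
  by_cases h : x.1.head? = some α
  · rw [hcons (cons_step_of_head h).symm, step_step]
  · exact hcons (step_of_not_head h)

theorem exists_place_eq (π : Equiv.Perm ι) (x y : Word ι) : ∃ g, place π g x = y := by
  induction x using step_induction generalizing y with
  | h0 => exact ⟨y, rfl⟩
  | hs α x ih =>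
    obtain ⟨g, hg⟩ := ih (step (π α) y)
    exact ⟨g, by rw [place_step, hg, step_step]⟩

theorem eq_self_of_map_step {f : Word ι → Word ι} (hf : ∀ α x, f (step α x) = step α (f x))
    {x : Word ι} (hx : f x = x) (y : Word ι) : f y = y := by
  have hnil : f nil = nil := by
    induction x using step_induction with
    | h0 => exact hx
    | hs α x ih => exact ih (by rw [← step_step α x, hf, hx])
  induction y using step_induction with
  | h0 => exact hnil
  | hs α y ih => rw [hf, ih]

theorem leftInverse_place {π π' : Equiv.Perm ι} (hπ : ∀ α, π' (π α) = α) {g h x : Word ι}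
    (hx : place π' h (place π g x) = x) :
    Function.LeftInverse (place π' h) (place π g) :=
  eq_self_of_map_step (fun α x => by rw [place_step, place_step, hπ]) hx

theorem exists_permutesColors (x y : Word ι) (π : Equiv.Perm ι) :
    ∃ φ : tree ι ≃g tree ι, PermutesColors φ π ∧ φ x = y := by
  obtain ⟨g, hg⟩ := exists_place_eq π x y
  obtain ⟨h, hh⟩ := exists_place_eq π.symm y x
  have hleft : Function.LeftInverse (place π.symm h) (place π g) :=
    leftInverse_place (x := x) π.symm_apply_apply (by rw [hg, hh])
  have hright : Function.LeftInverse (place π g) (place π.symm h) :=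
    leftInverse_place (x := y) π.apply_symm_apply (by rw [hh, hg])
  refine ⟨⟨⟨place π g, place π.symm h, hleft, hright⟩, ⟨?_, ?_⟩⟩, place_step π g, hg⟩
  · rintro ⟨α, hα⟩
    exact ⟨π.symm α, by
      rw [← hleft.injective.eq_iff, place_step, π.apply_symm_apply]; exact hα⟩
  · rintro ⟨α, rfl⟩
    exact ⟨π α, place_step π g α _⟩

/-- The vertex reached from `x` along the colours `e 0, e 1, …, e (j - 1)`. -/
def follow (e : ℕ → ι) (x : Word ι) : ℕ → Word ι
  | 0 => x
  | j + 1 => step (e j) (follow e x j)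

theorem follow_apply {φ : tree ι ≃g tree ι} {π : Equiv.Perm ι} (hφ : PermutesColors φ π)
    (e : ℕ → ι) (x : Word ι) (j : ℕ) : φ (follow e x j) = follow (fun i => π (e i)) (φ x) j := by
  induction j with
  | zero => rfl
  | succ j ih => rw [follow, follow, hφ, ih]

theorem follow_add (e : ℕ → ι) (x : Word ι) (i j : ℕ) :
    follow e x (i + j) = follow (fun k => e (i + k)) (follow e x i) j := by
  induction j with
  | zero => rfl
  | succ j ih => rw [← Nat.add_assoc, follow, follow, ih]

theorem dist_follow_le (e : ℕ → ι) (x : Word ι) (j : ℕ) : (tree ι).dist x (follow e x j) ≤ j := by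
  induction j with
  | zero => simp [follow]
  | succ j ih =>
    have htri := connected_tree.dist_triangle (u := x) (v := follow e x j)
      (w := follow e x (j + 1))
    have hstep : (tree ι).dist (follow e x j) (follow e x (j + 1)) = 1 := dist_step _ _
    omega

theorem len_follow {e : ℕ → ι} (he : ∀ j, e j ≠ e (j + 1)) {x : Word ι}
    (hx : x.1.head? ≠ some (e 0)) (j : ℕ) : (follow e x j).len = x.len + j := by
  have hhead : ∀ j, (follow e x j).1.head? ≠ some (e j) := by
    intro j
    induction j with
    | zero => exact hx
    | succ j ih =>
      rw [follow, step_of_not_head ih, List.head?_cons]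
      exact fun h => he j (Option.some.inj h)
  induction j with
  | zero => rfl
  | succ j ih => rw [follow, len_step_of_not_head (hhead j), ih, Nat.add_assoc]

theorem dist_follow {e : ℕ → ι} (he : ∀ j, e j ≠ e (j + 1)) {x : Word ι}
    (hx : x.1.head? ≠ some (e 0)) (i j : ℕ) :
    (tree ι).dist (follow e x i) (follow e x (i + j)) = j := by
  have hlen := len_le_add_dist (follow e x i) (follow e x (i + j))
  rw [len_follow he hx, len_follow he hx] at hlen
  have hle := dist_follow_le (fun k => e (i + k)) (follow e x i) j
  rw [← follow_add] at hle
  omega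

theorem follow_alternate_reverse (α β : ι) (x : Word ι) {m j : ℕ} (hj : j ≤ m + 1) :
    follow (alternate (alternate α β m) (alternate α β (m + 1)))
      (follow (alternate α β) x (m + 1)) j = follow (alternate α β) x (m + 1 - j) := by
  induction j with
  | zero => rfl
  | succ j ih =>
    have hcolor : alternate α β (m + j) = alternate α β (m - j) := by
      have : Even (m + j) ↔ Even (m - j) := by grind
      simp only [alternate, this]
    rw [follow, ih (by omega), alternate_shift, hcolor, show m + 1 - j = m - j + 1 by omega,
      follow, step_step, Nat.add_sub_add_right]

section Core

variable {ι : Type*} [DecidableEq ι] [Fintype ι] {T : ℕ}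

/-- The core of level `i` around `v`. The core of level `i + 1` contains the cores of level `i`
around all vertices of the two-coloured paths of length `2 ^ i * T` that start at `v`; this length
exceeds the radius `(2 ^ i - 1) * T` of the cores of level `i` by `T`. -/
def core (T : ℕ) : ℕ → Word ι → Finset (Word ι)
  | 0, v => {v}
  | i + 1, v => (Finset.univ : Finset (ι × ι)).biUnion fun c =>
      (Finset.range (2 ^ i * T + 1)).biUnion fun j => core T i (follow (alternate c.1 c.2) v j)

theorem mem_core_zero {v x : Word ι} : x ∈ core T 0 v ↔ x = v := Finset.mem_singleton

theorem mem_core_succ {i : ℕ} {v x : Word ι} :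
    x ∈ core T (i + 1) v ↔
      ∃ α β, ∃ j ≤ 2 ^ i * T, x ∈ core T i (follow (alternate α β) v j) := by
  simp only [core, Finset.mem_biUnion, Finset.mem_univ, true_and, Prod.exists, Finset.mem_range,
    Nat.lt_succ_iff]

theorem core_follow_subset {i j : ℕ} (α β : ι) (v : Word ι) (hj : j ≤ 2 ^ i * T) :
    core T i (follow (alternate α β) v j) ⊆ core T (i + 1) v := fun _ hx =>
  mem_core_succ.2 ⟨α, β, j, hj, hx⟩

theorem core_mono [Nonempty ι] (v : Word ι) : Monotone fun i => core T i v :=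
  monotone_nat_of_le_succ fun _ _ hx =>
    mem_core_succ.2 ⟨Classical.arbitrary ι, Classical.arbitrary ι, 0, Nat.zero_le _, hx⟩

theorem self_mem_core [Nonempty ι] (i : ℕ) (v : Word ι) : v ∈ core T i v :=
  core_mono v (Nat.zero_le i) (mem_core_zero.2 rfl)

theorem follow_mem_core [Nonempty ι] {i : ℕ} (hi : 1 ≤ i) (α β : ι) (v : Word ι) {j : ℕ}
    (hj : j ≤ T) : follow (alternate α β) v j ∈ core T i v :=
  core_mono v hi (mem_core_succ.2 ⟨α, β, j, by simpa using hj, mem_core_zero.2 rfl⟩)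

theorem step_mem_core [Nonempty ι] (hT : 1 ≤ T) {i : ℕ} (hi : 1 ≤ i) (α : ι) (v : Word ι) :
    step α v ∈ core T i v :=
  follow_mem_core hi α α v hT

theorem exists_mem_core_len_eq [Nontrivial ι] {i : ℕ} (hi : 1 ≤ i) (v : Word ι) :
    ∃ x ∈ core T i v, x.len = v.len + T := by
  obtain ⟨α, hα⟩ := exists_head_ne v
  obtain ⟨β, hβ⟩ := exists_ne α
  exact ⟨_, follow_mem_core hi α β v le_rfl, len_follow (alternate_ne hβ.symm) hα T⟩

theorem dist_add_le_of_mem_core {i : ℕ} {v x : Word ι} (hx : x ∈ core T i v) :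
    (tree ι).dist v x + T ≤ 2 ^ i * T := by
  induction i generalizing v with
  | zero => simp [mem_core_zero.1 hx]
  | succ i ih =>
    obtain ⟨α, β, j, hj, hx⟩ := mem_core_succ.1 hx
    have htri := connected_tree.dist_triangle (u := v) (v := follow (alternate α β) v j) (w := x)
    have hv := dist_follow_le (alternate α β) v j
    have hpow : 2 ^ (i + 1) * T = 2 ^ i * T + 2 ^ i * T := by ring
    have := ih hx
    omega

theorem card_core_le {i m : ℕ} (him : i ≤ m) (v : Word ι) :
    (core T i v).card ≤ (Fintype.card ι ^ 2 * (2 ^ m * T + 1)) ^ i := by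
  induction i generalizing v with
  | zero => simp [core]
  | succ i ih =>
    set b := (Fintype.card ι ^ 2 * (2 ^ m * T + 1)) ^ i
    calc (core T (i + 1) v).card
        ≤ (Finset.univ : Finset (ι × ι)).card * ((2 ^ i * T + 1) * b) := by
          refine Finset.card_biUnion_le_card_mul _ _ _ fun c _ => ?_
          simpa only [Finset.card_range] using
            Finset.card_biUnion_le_card_mul (Finset.range (2 ^ i * T + 1)) _ b fun j _ =>
              ih (by omega) (follow (alternate c.1 c.2) v j)
      _ = Fintype.card ι ^ 2 * (2 ^ i * T + 1) * b := by
          rw [Finset.card_univ, Fintype.card_prod]; ring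
      _ ≤ Fintype.card ι ^ 2 * (2 ^ m * T + 1) * b := by gcongr <;> omega
      _ = (Fintype.card ι ^ 2 * (2 ^ m * T + 1)) ^ (i + 1) := by exact (pow_succ' _ _).symm

theorem connected_core [Nonempty ι] (i : ℕ) (v : Word ι) :
    ((tree ι).induce (core T i v : Set (Word ι))).Connected := by
  induction i generalizing v with
  | zero =>
    rw [core, Finset.coe_singleton]
    exact SimpleGraph.Connected.of_subsingleton
  | succ i ih =>
    refine SimpleGraph.induce_connected_of_patches v (self_mem_core _ _) fun {x} hx => ?_
    obtain ⟨α, β, j, hj, hx⟩ := mem_core_succ.1 hx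
    set s : Set (Word ι) :=
      ⋃ k ≤ 2 ^ i * T, (core T i (follow (alternate α β) v k) : Set (Word ι))
    have hs : ((tree ι).induce s).Connected :=
      connected_induce_iUnion_le (w := follow (alternate α β) v) (fun k _ => ih _)
        (fun k _ => self_mem_core _ _) (fun k _ => adj_step _ _)
    have hvs : v ∈ s := Set.mem_biUnion (Set.mem_Iic.2 (Nat.zero_le _)) (self_mem_core _ _)
    have hxs : x ∈ s := Set.mem_biUnion hj hx
    refine ⟨s, fun y hy => ?_, hvs, hxs, hs.preconnected _ _⟩
    obtain ⟨k, hk, hy⟩ := Set.mem_iUnion₂.1 hy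
    exact mem_core_succ.2 ⟨α, β, k, hk, hy⟩

theorem image_core_subset {φ : tree ι ≃g tree ι} {π : Equiv.Perm ι} (hφ : PermutesColors φ π)
    (i : ℕ) (v : Word ι) : core T i (φ v) ⊆ (core T i v).image φ := by
  induction i generalizing v with
  | zero => simp [core]
  | succ i ih =>
    intro x hx
    obtain ⟨α, β, j, hj, hx⟩ := mem_core_succ.1 hx
    have hfollow : φ (follow (alternate (π.symm α) (π.symm β)) v j) =
        follow (alternate α β) (φ v) j := by
      simp only [follow_apply hφ, apply_alternate, π.apply_symm_apply]
    rw [← hfollow] at hx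
    exact Finset.image_subset_image
      (fun y hy => mem_core_succ.2 ⟨_, _, j, hj, hy⟩) (ih _ hx)

end Core

section Output

variable {ι : Type*} [DecidableEq ι] {Λ : Type*}

/-- The part of `U` in the ball of radius `r` around `v`. -/
def ball (U : Finset (Word ι)) (r : ℕ) (v : Word ι) : Set (Word ι) :=
  {a | a ∈ U ∧ (tree ι).dist v a ≤ r}

/-- The radius-`r` neighbourhood of `v` in the subtree induced on `U`, with the identifiers `f`.
Distances are taken in the infinite tree; for connected `U` they agree with those in the
subtree. -/
def view (U : Finset (Word ι)) (f : Word ι → ℕ) (r : ℕ) (v : Word ι) : View where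
  root := f v
  verts := f '' ball U r v
  edges := {e | ∃ a ∈ ball U r v, ∃ b ∈ ball U r v, (tree ι).Adj a b ∧ e = s(f a, f b)}

/-- The label that the rule `F` of radius `r` gives to the half-edge of colour `α` at `v`. -/
def output (F : View → ℕ ⊕ ℕ → Λ) (r : ℕ) (U : Finset (Word ι)) (f : Word ι → ℕ) (v : Word ι)
    (α : ι) : Λ :=
  F (view U f r v) (Sum.inl (f (step α v)))

/-- The multiset of labels that the rule `F` of radius `r` gives to the half-edges at `v`. -/
def config [Fintype ι] (F : View → ℕ ⊕ ℕ → Λ) (r : ℕ) (U : Finset (Word ι)) (f : Word ι → ℕ)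
    (v : Word ι) : Multiset Λ :=
  (Finset.univ : Finset ι).val.map (output F r U f v)

variable {F : View → ℕ ⊕ ℕ → Λ} {r : ℕ} {U U' : Finset (Word ι)} {f f' : Word ι → ℕ} {v : Word ι}

theorem view_congr (hU : ball U r v = ball U' r v) (hf : Set.EqOn f f' (ball U r v))
    (hv : f v = f' v) : view U f r v = view U' f' r v := by
  refine View.mk.injEq .. ▸ ⟨hv, ?_, ?_⟩
  · rw [← hU, hf.image_eq]
  · ext e
    simp only [← hU, Set.mem_ofPred_eq]
    refine exists_congr fun a => and_congr_right fun ha => exists_congr fun b =>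
      and_congr_right fun hb => ?_
    rw [hf ha, hf hb]

theorem output_congr (hv : v ∈ U) (hs : ∀ α, step α v ∈ U) (hUU' : U ⊆ U')
    (hU' : ∀ a ∈ U', (tree ι).dist v a ≤ r + 1 → a ∈ U)
    (hf : ∀ a ∈ U, (tree ι).dist v a ≤ r + 1 → f a = f' a) :
    output F r U f v = output F r U' f' v := by
  have hview : view U f r v = view U' f' r v := by
    refine view_congr (Set.ext fun a => and_congr_left fun ha => ?_)
      (fun a ha => hf a ha.1 (by have := ha.2; omega)) (hf v hv (by simp))
    exact ⟨fun h => hUU' h, fun h => hU' a h (by omega)⟩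
  funext α
  rw [output, output, hview, hf _ (hs α) (by rw [dist_step]; omega)]

theorem ball_image (φ : tree ι ≃g tree ι) (U : Finset (Word ι)) (r : ℕ) (v : Word ι) :
    ball (U.image φ) r (φ v) = φ '' ball U r v := by
  ext a
  obtain ⟨a, rfl⟩ := φ.surjective a
  rw [φ.injective.mem_set_image]
  simp only [ball, Set.mem_ofPred_eq, φ.injective.mem_finset_image, dist_apply]

theorem view_image (φ : tree ι ≃g tree ι) (U : Finset (Word ι)) (f : Word ι → ℕ) (r : ℕ)
    (v : Word ι) : view (U.image φ) (f ∘ φ.symm) r (φ v) = view U f r v := by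
  simp only [view, ball_image, Set.image_image, Set.exists_mem_image, Function.comp_apply,
    φ.symm_apply_apply, φ.map_adj_iff]

theorem output_image {φ : tree ι ≃g tree ι} {π : Equiv.Perm ι} (hφ : PermutesColors φ π)
    (F : View → ℕ ⊕ ℕ → Λ) (r : ℕ) (U : Finset (Word ι)) (f : Word ι → ℕ) (v : Word ι) (α : ι) :
    output F r (U.image φ) (f ∘ φ.symm) (φ v) (π α) = output F r U f v α := by
  rw [output, output, view_image, ← hφ, Function.comp_apply, φ.symm_apply_apply]

theorem viewAt_induce (hU : ((tree ι).induce (U : Set (Word ι))).Connected) (f : Word ι → ℕ)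
    (r : ℕ) (v : (U : Set (Word ι))) :
    viewAt ((tree ι).induce (U : Set (Word ι))) (fun x => f x) r v = view U f r v := by
  refine View.mk.injEq .. ▸ ⟨rfl, ?_, ?_⟩
  · ext i
    simp only [dist_induce_of_isTree isTree_tree hU, Set.mem_ofPred_eq, Subtype.exists, ball,
      Set.mem_image, Finset.mem_coe, exists_prop, and_assoc]
  · ext e
    simp only [dist_induce_of_isTree isTree_tree hU, Set.mem_ofPred_eq, Subtype.exists, ball,
      Finset.mem_coe, exists_prop, and_assoc, SimpleGraph.comap_adj,
      Function.Embedding.subtype_apply]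
    grind

end Output

/-- `U` spans a subtree, and `f` gives distinct identifiers from `{1, …, n}` to its vertices. -/
structure IsIdentifiedTree {ι : Type*} [DecidableEq ι] (n : ℕ) (U : Finset (Word ι))
    (f : Word ι → ℕ) : Prop where
  connected : ((tree ι).induce (U : Set (Word ι))).Connected
  isIdentOn : IsIdentOn n U f

theorem IsIdentifiedTree.image {ι : Type*} [DecidableEq ι] {n : ℕ} {U : Finset (Word ι)}
    {f : Word ι → ℕ} (h : IsIdentifiedTree n U f) (φ : tree ι ≃g tree ι) :
    IsIdentifiedTree n (U.image φ) (f ∘ φ.symm) := by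
  have himage : ∀ x ∈ U.image φ, φ.symm x ∈ U := by
    simp only [Finset.forall_mem_image, φ.symm_apply_apply, imp_self, implies_true]
  refine ⟨?_, h.isIdentOn.1.comp φ.symm.injective.injOn himage, fun x hx =>
    h.isIdentOn.2 (himage x hx)⟩
  rw [Finset.coe_image, ← (φ.induce φ.injective.injOn.bijOn_image).connected_iff]
  exact h.connected

end Word

/-- The rule `F` of radius `r` returns a correct solution of `P` on every finite `Δ`-regular tree
with `n` vertices that carry distinct identifiers from `{1, …, n}`. -/
def SolvesOrder {Δ : ℕ} {Λ : Type*} (P : LCL Δ Λ) (F : View → ℕ ⊕ ℕ → Λ) (n r : ℕ) : Prop :=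
  ∀ (V : Type) [Fintype V] (G : SimpleGraph V) [DecidableRel G.Adj],
    IsRegularTree Δ G → Fintype.card V = n → ∀ ident : V → ℕ, Function.Injective ident →
      (∀ v, ident v ∈ Set.Icc 1 n) →
      IsSolution P (LocalAlgorithm.run (fun _ => F) (fun _ => r) Δ G ident)

theorem HasLocalComplexity.exists_solvesOrder {Δ : ℕ} {Λ : Type*} {P : LCL Δ Λ} {t : ℕ → ℕ}
    (h : HasLocalComplexity P t) (n : ℕ) : ∃ F, SolvesOrder P F n (t n) := by
  obtain ⟨C, hC, A, hA⟩ := h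
  refine ⟨A n, fun V _ G _ hG hn ident hinj hident => ?_⟩
  subst hn
  exact hA V G hG ident hinj fun v => Finset.mem_Icc.2
    ⟨(hident v).1, (hident v).2.trans (Nat.le_self_pow (by omega) _)⟩

namespace Word

section Correctness

variable {Δ : ℕ} {Λ : Type*} {P : LCL Δ Λ} {F : View → ℕ ⊕ ℕ → Λ} {n r : ℕ}
  {U : Finset (Word (Fin Δ))} {f : Word (Fin Δ) → ℕ} {v : Word (Fin Δ)}

open Classical in
theorem degree_induce_le (U : Finset (Word (Fin Δ))) (v : (U : Set (Word (Fin Δ)))) :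
    ((tree (Fin Δ)).induce (U : Set (Word (Fin Δ)))).degree v ≤ Δ := by
  rw [← SimpleGraph.card_neighborSet_eq_degree]
  choose c hc using
    fun w : ((tree (Fin Δ)).induce (U : Set (Word (Fin Δ)))).neighborSet v => w.2
  have hinj : Function.Injective c := fun a b hab =>
    Subtype.ext (Subtype.ext ((hc a).trans ((congrArg (step · v.1) hab).trans (hc b).symm)))
  simpa only [Fintype.card_fin] using Fintype.card_le_of_injective c hinj

open Classical in
theorem bijective_step_halfEdgeAt (hv : v ∈ U) (hs : ∀ α, step α v ∈ U) :
    Function.Bijective fun α : Fin Δ =>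
      (Sum.inl ⟨⟨step α v, hs α⟩, adj_step α v⟩ :
        HalfEdgeAt Δ ((tree (Fin Δ)).induce (U : Set (Word (Fin Δ)))) ⟨v, hv⟩) := by
  refine (Fintype.bijective_iff_injective_and_card _).2 ⟨fun α β h => ?_, ?_⟩
  · exact step_left_injective v (congrArg (fun x => (x.1 : Word (Fin Δ))) (Sum.inl.inj h))
  · rw [Fintype.card_sum, SimpleGraph.card_neighborSet_eq_degree, Fintype.card_fin,
      Fintype.card_fin, Nat.add_sub_cancel' (degree_induce_le U _)]

open Classical in
theorem run_inl (hU : IsIdentifiedTree n U f) (x : (U : Set (Word (Fin Δ))))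
    (y : ((tree (Fin Δ)).induce (U : Set (Word (Fin Δ)))).neighborSet x) :
    LocalAlgorithm.run (fun _ => F) (fun _ => r) Δ
        ((tree (Fin Δ)).induce (U : Set (Word (Fin Δ)))) (fun x => f x) x (Sum.inl y) =
      F (view U f r x) (Sum.inl (f y)) := by
  rw [LocalAlgorithm.run, viewAt_induce hU.connected]
  rfl

open Classical in
theorem isSolution_induce (hF : SolvesOrder P F n r) (hU : IsIdentifiedTree n U f)
    (hn : U.card = n) :
    IsSolution P (LocalAlgorithm.run (fun _ => F) (fun _ => r) Δ
      ((tree (Fin Δ)).induce (U : Set (Word (Fin Δ)))) fun x => f x) :=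
  hF _ _ ⟨⟨hU.connected, isTree_tree.2.induce _⟩, degree_induce_le U⟩ (by simpa using hn) _
    (fun a b hab => Subtype.ext (hU.isIdentOn.1 a.2 b.2 hab)) fun x => hU.isIdentOn.2 x.2

theorem config_mem_of_card_eq (hF : SolvesOrder P F n r) (hU : IsIdentifiedTree n U f)
    (hn : U.card = n) (hv : v ∈ U) (hs : ∀ α, step α v ∈ U) :
    config F r U f v ∈ P.vertexConfigs := by
  classical
  have hmem := (isSolution_induce hF hU hn).1 ⟨v, hv⟩
  rw [configAt, ← Multiset.map_univ_val_equiv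
    (Equiv.ofBijective _ (bijective_step_halfEdgeAt hv hs)), Multiset.map_map] at hmem
  convert hmem using 1
  exact Multiset.map_congr rfl fun α _ => (run_inl hU ⟨v, hv⟩ ⟨⟨step α v, hs α⟩, adj_step α v⟩).symm

theorem edge_mem_of_card_eq (hF : SolvesOrder P F n r) (hU : IsIdentifiedTree n U f)
    (hn : U.card = n) (hv : v ∈ U) {α : Fin Δ} (hα : step α v ∈ U) :
    s(output F r U f v α, output F r U f (step α v) α) ∈ P.edgeConfigs := by
  classical
  have hmem := (isSolution_induce hF hU hn).2 ⟨v, hv⟩ ⟨step α v, hα⟩ (adj_step α v)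
  simp only [edgeConfig, run_inl hU] at hmem
  rwa [output, output, step_step]

end Correctness

section Padding

variable {ι : Type*} [DecidableEq ι] {n : ℕ} {U : Finset (Word ι)}

theorem connected_induce_insert_step {x : Word ι} (hx : x ∈ U)
    (hU : ((tree ι).induce (U : Set (Word ι))).Connected) (α : ι) :
    ((tree ι).induce (↑(insert (step α x) U) : Set (Word ι))).Connected := by
  rw [Finset.coe_insert, Set.insert_eq]
  exact SimpleGraph.connected_induce_union SimpleGraph.Preconnected.of_subsingleton
    hU.preconnected (Set.mem_singleton _) hx (adj_step α x).symm

theorem exists_pad [Nontrivial ι] (hU : ((tree ι).induce (U : Set (Word ι))).Connected)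
    (hn : U.card ≤ n) :
    ∃ U' : Finset (Word ι), U ⊆ U' ∧ ((tree ι).induce (U' : Set (Word ι))).Connected ∧
      U'.card = n ∧ ∀ x ∈ U', x ∉ U → ∀ y ∈ U, y.len < x.len := by
  induction n, hn using Nat.le_induction with
  | base => exact ⟨U, subset_rfl, hU, rfl, fun x hx hx' => absurd hx hx'⟩
  | succ n _ ih =>
    obtain ⟨W, hUW, hW, hcard, hdeep⟩ := ih
    obtain ⟨⟨v, hv⟩⟩ := hW.nonempty
    obtain ⟨x, hx, hmax⟩ := W.exists_max_image len ⟨v, hv⟩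
    obtain ⟨α, hα⟩ := exists_head_ne x
    have hdeeper : ∀ y ∈ W, y.len < (step α x).len := fun y hy => by
      rw [len_step_of_not_head hα]
      exact Nat.lt_succ_of_le (hmax y hy)
    have hnew : step α x ∉ W := fun h => (hdeeper _ h).false
    refine ⟨insert (step α x) W, hUW.trans (Finset.subset_insert _ _),
      connected_induce_insert_step hx hW α, by rw [Finset.card_insert_of_notMem hnew, hcard],
      fun y hy hyU z hz => ?_⟩
    rcases Finset.mem_insert.1 hy with rfl | hy
    · exact hdeeper z (hUW hz)
    · exact hdeep y hy hyU z hz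

theorem IsIdentifiedTree.exists_pad [Nontrivial ι] {f : Word ι → ℕ}
    (h : IsIdentifiedTree n U f) :
    ∃ U' f', U ⊆ U' ∧ IsIdentifiedTree n U' f' ∧ U'.card = n ∧ Set.EqOn f' f U ∧
      ∀ x ∈ U', x ∉ U → ∀ y ∈ U, y.len < x.len := by
  obtain ⟨U', hUU', hU', hcard, hdeep⟩ := Word.exists_pad h.connected h.isIdentOn.card_le
  obtain ⟨f', hf'f, hf', -⟩ := h.isIdentOn.exists_extension hUU' (F := ∅) (by simp [hcard])
  exact ⟨U', f', hUU', ⟨hU', hf'⟩, hcard, hf'f, hdeep⟩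

/-- The core around `v` contains a vertex that is `r + 1` levels deeper than `v`, so that the
vertices of the padding are too deep to be seen from `v`. -/
theorem output_eq_of_forall_len_lt [Fintype ι] [Nontrivial ι] {Λ : Type*} (F : View → ℕ ⊕ ℕ → Λ)
    {r i : ℕ} {U' : Finset (Word ι)} {f f' : Word ι → ℕ} (hUU' : U ⊆ U') (hf : Set.EqOn f' f U)
    (hdeep : ∀ x ∈ U', x ∉ U → ∀ y ∈ U, y.len < x.len) (hi : 1 ≤ i) {v : Word ι}
    (hv : core (r + 1) i v ⊆ U) : output F r U f v = output F r U' f' v := by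
  refine output_congr (hv (self_mem_core i v)) (fun α => hv (step_mem_core (by omega) hi α v)) hUU'
    (fun a ha hdist => ?_) fun a ha _ => (hf ha).symm
  by_contra hna
  obtain ⟨y, hy, hylen⟩ := exists_mem_core_len_eq (T := r + 1) hi v
  have hlt := hdeep a ha hna y (hv hy)
  have hle := len_le_add_dist v a
  omega

end Padding

section CoreCorrectness

variable {Δ : ℕ} [Nontrivial (Fin Δ)] {Λ : Type*} {P : LCL Δ Λ} {F : View → ℕ ⊕ ℕ → Λ} {n r i : ℕ}
  {U : Finset (Word (Fin Δ))} {f : Word (Fin Δ) → ℕ} {v : Word (Fin Δ)}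

theorem config_mem_of_core_subset (hF : SolvesOrder P F n r) (hU : IsIdentifiedTree n U f)
    (hi : 1 ≤ i) (hv : core (r + 1) i v ⊆ U) : config F r U f v ∈ P.vertexConfigs := by
  obtain ⟨U', f', hUU', hU', hcard, hf, hdeep⟩ := hU.exists_pad
  rw [config, output_eq_of_forall_len_lt F hUU' hf hdeep hi hv]
  exact config_mem_of_card_eq hF hU' hcard (hUU' (hv (self_mem_core i v)))
    fun α => hUU' (hv (step_mem_core (by omega) hi α v))

theorem edge_mem_of_core_subset (hF : SolvesOrder P F n r) (hU : IsIdentifiedTree n U f)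
    (hi : 1 ≤ i) (hv : core (r + 1) i v ⊆ U) {α : Fin Δ} (hα : core (r + 1) i (step α v) ⊆ U) :
    s(output F r U f v α, output F r U f (step α v) α) ∈ P.edgeConfigs := by
  obtain ⟨U', f', hUU', hU', hcard, hf, hdeep⟩ := hU.exists_pad
  rw [output_eq_of_forall_len_lt F hUU' hf hdeep hi hv,
    output_eq_of_forall_len_lt F hUU' hf hdeep hi hα]
  exact edge_mem_of_card_eq hF hU' hcard (hUU' (hv (self_mem_core i v)))
    (hUU' (hα (self_mem_core i _)))

end CoreCorrectness

end Word

theorem joint_of_map_univ_mem {ι Λ : Type*} [Fintype ι] {S : Set (Multiset Λ)} {f : ι → Λ}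
    (h : (Finset.univ : Finset ι).val.map f ∈ S) {a b : ι} (hab : a ≠ b) :
    Joint S (f a) (f b) := by
  classical
  refine ⟨_, h, ?_⟩
  have hle := Multiset.map_le_map (f := f)
    (Finset.val_le_iff.2 (Finset.subset_univ ({a, b} : Finset ι)))
  rwa [Finset.insert_val_of_notMem (Finset.notMem_singleton.2 hab), Finset.singleton_val,
    Multiset.map_cons, Multiset.map_singleton] at hle

namespace Word

section CoreConfigs

variable {ι : Type*} [DecidableEq ι] [Fintype ι] {Λ : Type*} {F : View → ℕ ⊕ ℕ → Λ}
  {n r i N : ℕ}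

/-- The configurations that the rule `F` of radius `r` produces, with identifiers from
`{1, …, n}`, at vertices surrounded by a core of level `i` in subtrees with at most `N` vertices. -/
def coreConfigs (F : View → ℕ ⊕ ℕ → Λ) (n r : ℕ) (ι : Type*) [DecidableEq ι] [Fintype ι]
    (i N : ℕ) : Set (Multiset Λ) :=
  {c | ∃ (U : Finset (Word ι)) (f : Word ι → ℕ) (v : Word ι), IsIdentifiedTree n U f ∧
    U.card ≤ N ∧ core (r + 1) i v ⊆ U ∧ config F r U f v = c}

theorem coreConfigs_mono [Nonempty ι] {i' N' : ℕ} (hi : i' ≤ i) (hN : N ≤ N') :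
    coreConfigs F n r ι i N ⊆ coreConfigs F n r ι i' N' := fun _ ⟨U, f, v, hU, hcard, hv, hc⟩ =>
  ⟨U, f, v, hU, hcard.trans hN, (core_mono v hi).trans hv, hc⟩

theorem coreConfigs_nonempty [Nonempty ι] {v : Word ι} (hN : (core (r + 1) i v).card ≤ N)
    (hn : (core (r + 1) i v).card ≤ n) : (coreConfigs F n r ι i N).Nonempty := by
  obtain ⟨f, hf, -⟩ := exists_isIdentOn_avoiding (n := n) (D := core (r + 1) i v) (F := ∅)
    (by simpa using hn)
  exact ⟨_, _, f, v, ⟨connected_core i v, hf⟩, hN, subset_rfl, rfl⟩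

theorem exists_output_eq_of_mem_coreConfigs {c : Multiset Λ} (hc : c ∈ coreConfigs F n r ι i N)
    {a : Λ} (ha : a ∈ c) (v : Word ι) (α : ι) :
    ∃ U f, IsIdentifiedTree n U f ∧ U.card ≤ N ∧ core (r + 1) i v ⊆ U ∧
      output F r U f v α = a := by
  obtain ⟨U, f, w, hU, hcard, hw, rfl⟩ := hc
  obtain ⟨β, -, rfl⟩ := Multiset.mem_map.1 ha
  obtain ⟨φ, hφ, rfl⟩ := exists_permutesColors w v (Equiv.swap β α)
  refine ⟨U.image φ, f ∘ φ.symm, hU.image φ, Finset.card_image_le.trans hcard,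
    (image_core_subset hφ i w).trans (Finset.image_subset_image hw), ?_⟩
  rw [← output_image hφ F r U f w β, Equiv.swap_apply_left]

end CoreConfigs

section Bridge

variable {ι : Type*} [DecidableEq ι] [Fintype ι] {T i m : ℕ} {z : ℕ → Word ι}
  {U₁ U₂ : Finset (Word ι)}

/-- The two subtrees `U₁` and `U₂`, around the ends of the path `z 0, …, z (m + 1)`, joined by the
cores of level `i` around the vertices of this path. -/
def bridge (T i m : ℕ) (z : ℕ → Word ι) (U₁ U₂ : Finset (Word ι)) : Finset (Word ι) :=
  U₁ ∪ U₂ ∪ (Finset.range (m + 2)).biUnion fun j => core T i (z j)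

theorem mem_bridge {x : Word ι} :
    x ∈ bridge T i m z U₁ U₂ ↔ x ∈ U₁ ∨ x ∈ U₂ ∨ ∃ j ≤ m + 1, x ∈ core T i (z j) := by
  simp only [bridge, Finset.mem_union, Finset.mem_biUnion, Finset.mem_range, or_assoc,
    Nat.lt_succ_iff]

theorem left_subset_bridge : U₁ ⊆ bridge T i m z U₁ U₂ := fun _ h => mem_bridge.2 (Or.inl h)

theorem right_subset_bridge : U₂ ⊆ bridge T i m z U₁ U₂ := fun _ h =>
  mem_bridge.2 (Or.inr (Or.inl h))

theorem core_subset_bridge {j : ℕ} (hj : j ≤ m + 1) : core T i (z j) ⊆ bridge T i m z U₁ U₂ :=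
  fun _ h => mem_bridge.2 (Or.inr (Or.inr ⟨j, hj, h⟩))

theorem bridge_reverse : bridge T i m (fun j => z (m + 1 - j)) U₂ U₁ = bridge T i m z U₁ U₂ := by
  ext x
  simp only [mem_bridge]
  have hreflect : (∃ j ≤ m + 1, x ∈ core T i (z (m + 1 - j))) ↔ ∃ j ≤ m + 1, x ∈ core T i (z j) :=
    ⟨fun ⟨j, _, hx⟩ => ⟨m + 1 - j, Nat.sub_le _ _, hx⟩,
      fun ⟨j, hj, hx⟩ => ⟨m + 1 - j, Nat.sub_le _ _, by rwa [Nat.sub_sub_self hj]⟩⟩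
  rw [hreflect]
  tauto

theorem card_bridge_le {K : ℕ} (hK : ∀ v : Word ι, (core T i v).card ≤ K) :
    (bridge T i m z U₁ U₂).card ≤ U₁.card + U₂.card + (m + 2) * K := by
  have hcores := Finset.card_biUnion_le_card_mul (Finset.range (m + 2)) _ K fun j _ => hK (z j)
  rw [Finset.card_range] at hcores
  exact (Finset.card_union_le _ _).trans (Nat.add_le_add (Finset.card_union_le _ _) hcores)

theorem connected_bridge [Nonempty ι] (hz : ∀ j ≤ m, (tree ι).Adj (z j) (z (j + 1)))
    (h₁ : ((tree ι).induce (U₁ : Set (Word ι))).Connected) (hz₁ : z 0 ∈ U₁)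
    (h₂ : ((tree ι).induce (U₂ : Set (Word ι))).Connected) (hz₂ : z (m + 1) ∈ U₂) :
    ((tree ι).induce (bridge T i m z U₁ U₂ : Set (Word ι))).Connected := by
  set W : Set (Word ι) := ⋃ j ≤ m + 1, (core T i (z j) : Set (Word ι)) with hWdef
  have hW : ((tree ι).induce W).Connected :=
    connected_induce_iUnion_le (fun j _ => connected_core i (z j))
      (fun j _ => self_mem_core i (z j)) fun j hj => hz j (Nat.lt_succ_iff.1 hj)
  have hzW : ∀ j ≤ m + 1, z j ∈ W := fun j hj => Set.mem_biUnion hj (self_mem_core i (z j))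
  have heq : (bridge T i m z U₁ U₂ : Set (Word ι)) = ↑U₁ ∪ (↑U₂ ∪ W) := by
    ext x
    simp only [Finset.mem_coe, mem_bridge, Set.mem_union, hWdef, Set.mem_iUnion, exists_prop]
  rw [heq]
  refine SimpleGraph.induce_union_connected h₁.preconnected
    (SimpleGraph.induce_union_connected h₂.preconnected hW.preconnected
      ⟨_, hz₂, hzW _ le_rfl⟩).preconnected ⟨_, hz₁, Or.inr (hzW 0 (Nat.zero_le _))⟩

theorem mem_left_of_mem_bridge {N : ℕ} (hz : ∀ j ≤ m + 1, (tree ι).dist (z 0) (z j) = j)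
    (h₁ : ∀ j ≤ m + 1, j ≤ 2 ^ i * T → core T i (z j) ⊆ U₁)
    (h₂ : ((tree ι).induce (U₂ : Set (Word ι))).Connected) (hz₂ : z (m + 1) ∈ U₂)
    (hcard : U₂.card ≤ N) (hm : T + N ≤ m) {x : Word ι} (hx : x ∈ bridge T i m z U₁ U₂)
    (hdist : (tree ι).dist (z 0) x ≤ T) : x ∈ U₁ := by
  have htri : ∀ j, (tree ι).dist (z 0) (z j) ≤ (tree ι).dist (z 0) x + (tree ι).dist (z j) x := by
    intro j
    rw [(tree ι).dist_comm (u := z j)]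
    exact connected_tree.dist_triangle
  rcases mem_bridge.1 hx with hx | hx | ⟨j, hj, hx⟩
  · exact hx
  · have hfar := hz (m + 1) le_rfl
    have hclose := dist_le_card_of_isTree isTree_tree h₂ hz₂ hx
    have := htri (m + 1)
    omega
  · have hclose := dist_add_le_of_mem_core hx
    have := htri j
    rw [hz j hj] at this
    exact h₁ j hj (by omega) hx

theorem mem_right_of_mem_bridge {N : ℕ}
    (hz : ∀ j ≤ m + 1, (tree ι).dist (z (m + 1)) (z (m + 1 - j)) = j)
    (h₂ : ∀ j ≤ m + 1, j ≤ 2 ^ i * T → core T i (z (m + 1 - j)) ⊆ U₂)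
    (h₁ : ((tree ι).induce (U₁ : Set (Word ι))).Connected) (hz₁ : z 0 ∈ U₁)
    (hcard : U₁.card ≤ N) (hm : T + N ≤ m) {x : Word ι} (hx : x ∈ bridge T i m z U₁ U₂)
    (hdist : (tree ι).dist (z (m + 1)) x ≤ T) : x ∈ U₂ :=
  mem_left_of_mem_bridge (z := fun j => z (m + 1 - j)) hz h₂ h₁ (by rwa [Nat.sub_self]) hcard hm
    (bridge_reverse (U₁ := U₁) (U₂ := U₂) ▸ hx) hdist

end Bridge

section Gluing

variable {ι : Type*} [DecidableEq ι] [Fintype ι] [Nonempty ι] {Λ : Type*} {n r i : ℕ}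

theorem output_eq_of_subset (F : View → ℕ ⊕ ℕ → Λ) (hi : 1 ≤ i) {U U' : Finset (Word ι)}
    {f f' : Word ι → ℕ} {v : Word ι} (hv : core (r + 1) i v ⊆ U) (hUU' : U ⊆ U')
    (hU' : ∀ a ∈ U', (tree ι).dist v a ≤ r + 1 → a ∈ U)
    (hf : ∀ a ∈ U, (tree ι).dist v a ≤ r + 1 → f a = f' a) :
    output F r U f v = output F r U' f' v :=
  output_congr (hv (self_mem_core i v)) (fun α => hv (step_mem_core (by omega) hi α v)) hUU' hU' hf

/-- Around `x` and `y` the identifiers are prescribed by `f₁` and `f₂`, which may clash. They are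
therefore kept in two different assignments, which look the same around `w`. -/
theorem exists_identifiers_of_far (F : View → ℕ ⊕ ℕ → Λ) (hi : 1 ≤ i)
    {U U₁ U₂ : Finset (Word ι)} {f₁ f₂ : Word ι → ℕ} (hf₁ : IsIdentOn n U₁ f₁)
    (hf₂ : IsIdentOn n U₂ f₂) (hU₁ : U₁ ⊆ U) (hU₂ : U₂ ⊆ U) (hn : U.card + U₂.card ≤ n)
    {x y w : Word ι} (hx : core (r + 1) (i + 1) x ⊆ U₁)
    (hxU : ∀ a ∈ U, (tree ι).dist x a ≤ r + 1 → a ∈ U₁) (hy : core (r + 1) (i + 1) y ⊆ U₂)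
    (hyU : ∀ a ∈ U, (tree ι).dist y a ≤ r + 1 → a ∈ U₂) (hw : core (r + 1) i w ⊆ U)
    (hxw : 2 * (r + 1) < (tree ι).dist x w) (hyw : 2 * (r + 1) < (tree ι).dist y w) :
    ∃ g₁ g₂, IsIdentOn n U g₁ ∧ IsIdentOn n U g₂ ∧
      output F r U g₁ x = output F r U₁ f₁ x ∧ output F r U g₂ y = output F r U₂ f₂ y ∧
      output F r U g₁ w = output F r U g₂ w := by
  set B₁ := U₁.filter fun a => (tree ι).dist x a ≤ r + 1
  set B₂ := U₂.filter fun a => (tree ι).dist y a ≤ r + 1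
  have hBU₁ : B₁ ⊆ U₁ := Finset.filter_subset _ _
  have hBU₂ : B₂ ⊆ U₂ := Finset.filter_subset _ _
  obtain ⟨g₁, g₂, hgf₁, hgf₂, hg₁, hg₂, hg⟩ :=
    exists_extension_pair (hBU₁.trans hU₁) (hBU₂.trans hU₂) (hf₁.mono hBU₁) (hf₂.mono hBU₂)
      ((Nat.add_le_add_left (Finset.card_le_card hBU₂) _).trans hn)
  refine ⟨g₁, g₂, hg₁, hg₂, (output_eq_of_subset F (by omega) hx hU₁ hxU fun a ha hd =>
    (hgf₁ (Finset.mem_filter.2 ⟨ha, hd⟩)).symm).symm, (output_eq_of_subset F (by omega) hy hU₂ hyU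
    fun a ha hd => (hgf₂ (Finset.mem_filter.2 ⟨ha, hd⟩)).symm).symm,
    output_eq_of_subset F hi hw subset_rfl (fun a ha _ => ha) fun a ha hd => ?_⟩
  have hnotMem : ∀ u, 2 * (r + 1) < (tree ι).dist u w → ¬ (tree ι).dist u a ≤ r + 1 := by
    intro u huw hua
    have htri := connected_tree.dist_triangle (u := u) (v := a) (w := w)
    rw [(tree ι).dist_comm (u := a)] at htri
    omega
  exact hg a ha (fun h => hnotMem x hxw (Finset.mem_filter.1 h).2)
    fun h => hnotMem y hyw (Finset.mem_filter.1 h).2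

theorem exists_bridge (F : View → ℕ ⊕ ℕ → Λ) (hi : 1 ≤ i) {α β : ι} (hαβ : α ≠ β) {K m N : ℕ}
    (hK : ∀ v : Word ι, (core (r + 1) i v).card ≤ K) (hm : N + 4 * (r + 1) < m)
    (hn : 3 * N + (m + 2) * K ≤ n) {z : ℕ → Word ι} (hz : z = follow (alternate α β) nil)
    {U₁ U₂ : Finset (Word ι)} {f₁ f₂ : Word ι → ℕ} (h₁ : IsIdentifiedTree n U₁ f₁)
    (hN₁ : U₁.card ≤ N) (hU₁ : core (r + 1) (i + 1) (z 0) ⊆ U₁) (h₂ : IsIdentifiedTree n U₂ f₂)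
    (hN₂ : U₂.card ≤ N) (hU₂ : core (r + 1) (i + 1) (z (m + 1)) ⊆ U₂) :
    ∃ U g₁ g₂, IsIdentifiedTree n U g₁ ∧ IsIdentifiedTree n U g₂ ∧
      U.card ≤ 2 * N + (m + 2) * K ∧ (∀ j ≤ m + 1, core (r + 1) i (z j) ⊆ U) ∧
      output F r U g₁ (z 0) = output F r U₁ f₁ (z 0) ∧
      output F r U g₂ (z (m + 1)) = output F r U₂ f₂ (z (m + 1)) ∧
      output F r U g₁ (z (2 * (r + 1) + 1)) = output F r U g₂ (z (2 * (r + 1) + 1)) := by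
  have hdist : ∀ j k, (tree ι).dist (z j) (z (j + k)) = k := by
    subst hz
    exact dist_follow (alternate_ne hαβ) (by simp [nil])
  have hdist₀ : ∀ j ≤ m + 1, (tree ι).dist (z 0) (z j) = j := fun j _ => by
    simpa using hdist 0 j
  have hdist' : ∀ j ≤ m + 1, (tree ι).dist (z (m + 1)) (z (m + 1 - j)) = j := by
    intro j hj
    have := hdist (m + 1 - j) j
    rwa [Nat.sub_add_cancel hj, SimpleGraph.dist_comm] at this
  have hz₁ : z 0 ∈ U₁ := hU₁ (self_mem_core _ _)
  have hz₂ : z (m + 1) ∈ U₂ := hU₂ (self_mem_core _ _)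
  set U := bridge (r + 1) i m z U₁ U₂
  have hcard : U.card ≤ 2 * N + (m + 2) * K := (card_bridge_le hK).trans (by omega)
  have hU : ((tree ι).induce (U : Set (Word ι))).Connected :=
    connected_bridge (fun j _ => by rw [hz]; exact adj_step _ _) h₁.connected hz₁ h₂.connected hz₂
  have hleft : ∀ a ∈ U, (tree ι).dist (z 0) a ≤ r + 1 → a ∈ U₁ := fun a =>
    mem_left_of_mem_bridge hdist₀ (fun j _ hj => by
      rw [hz] at hU₁ ⊢
      exact (core_follow_subset α β nil hj).trans hU₁) h₂.connected hz₂ hN₂ (by omega)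
  have hright : ∀ a ∈ U, (tree ι).dist (z (m + 1)) a ≤ r + 1 → a ∈ U₂ := fun a =>
    mem_right_of_mem_bridge hdist' (fun j hjm hj => by
      rw [hz] at hU₂ ⊢
      rw [← follow_alternate_reverse α β nil hjm]
      exact (core_follow_subset _ _ _ hj).trans hU₂) h₁.connected hz₁ hN₁ (by omega)
  have hcore : ∀ j ≤ m + 1, core (r + 1) i (z j) ⊆ U := fun j hj => core_subset_bridge hj
  obtain ⟨g₁, g₂, hg₁, hg₂, hout⟩ := exists_identifiers_of_far F hi h₁.isIdentOn h₂.isIdentOn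
    left_subset_bridge right_subset_bridge (by change U.card + _ ≤ n; omega) hU₁ hleft hU₂ hright
    (hcore (2 * (r + 1) + 1) (by omega)) (by rw [hdist₀ _ (by omega)]; omega)
    (by
      have := hdist' (m + 1 - (2 * (r + 1) + 1)) (by omega)
      rw [Nat.sub_sub_self (by omega)] at this
      omega)
  exact ⟨U, g₁, g₂, ⟨hU, hg₁⟩, ⟨hU, hg₂⟩, hcard, hcore, hout⟩

end Gluing

section CorePaths

variable {Δ : ℕ} [Nontrivial (Fin Δ)] {Λ : Type*} {P : LCL Δ Λ} {F : View → ℕ ⊕ ℕ → Λ}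
  {n r i N : ℕ}

theorem coreConfigs_subset (hF : SolvesOrder P F n r) (hi : 1 ≤ i) :
    coreConfigs F n r (Fin Δ) i N ⊆ P.vertexConfigs := by
  rintro _ ⟨U, f, v, hU, -, hv, rfl⟩
  exact config_mem_of_core_subset hF hU hi hv

theorem linkable_follow (hF : SolvesOrder P F n r) (hi : 1 ≤ i) {U : Finset (Word (Fin Δ))}
    {f : Word (Fin Δ) → ℕ} (hU : IsIdentifiedTree n U f) (hcard : U.card ≤ N) {e : ℕ → Fin Δ}
    (he : ∀ j, e j ≠ e (j + 1)) (x : Word (Fin Δ)) (s m : ℕ)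
    (hcore : ∀ j ≤ s + m + 1, core (r + 1) i (follow e x j) ⊆ U) :
    Linkable P (coreConfigs F n r (Fin Δ) i N) m (output F r U f (follow e x s) (e s))
      (output F r U f (follow e x (s + m + 1)) (e (s + m))) := by
  induction m with
  | zero => exact edge_mem_of_core_subset hF hU hi (hcore s (by omega)) (hcore (s + 1) (by omega))
  | succ m ih =>
    have hconfig : config F r U f (follow e x (s + m + 1)) ∈ coreConfigs F n r (Fin Δ) i N :=
      ⟨U, f, _, hU, hcard, hcore _ (by omega), rfl⟩
    have hlast : Linkable P (coreConfigs F n r (Fin Δ) i N) 0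
        (output F r U f (follow e x (s + m + 1)) (e (s + m + 1)))
        (output F r U f (follow e x (s + m + 2)) (e (s + m + 1))) :=
      edge_mem_of_core_subset hF hU hi (hcore (s + m + 1) (by omega))
        (hcore (s + m + 2) (by omega))
    exact (ih fun j hj => hcore j (by omega)).trans
      (joint_of_map_univ_mem hconfig (he (s + m))) hlast

theorem allLinkable_coreConfigs (hF : SolvesOrder P F n r) (hi : 1 ≤ i) {K m N' : ℕ}
    (hK : ∀ v : Word (Fin Δ), (core (r + 1) i v).card ≤ K) (hm : N + 4 * (r + 1) < m)
    (hN' : 2 * N + (m + 2) * K ≤ N') (hn : N' + N ≤ n)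
    (hstable : coreConfigs F n r (Fin Δ) (i + 1) N = coreConfigs F n r (Fin Δ) i N') :
    AllLinkable P (coreConfigs F n r (Fin Δ) i N') m := by
  intro c₁ hc₁ c₂ hc₂ a ha b hb
  rw [← hstable] at hc₁ hc₂
  obtain ⟨α, β, hαβ⟩ := exists_pair_ne (Fin Δ)
  set z := follow (alternate α β) nil with hz
  obtain ⟨U₁, f₁, h₁, hN₁, hU₁, rfl⟩ :=
    exists_output_eq_of_mem_coreConfigs hc₁ ha (z 0) (alternate α β 0)
  obtain ⟨U₂, f₂, h₂, hN₂, hU₂, rfl⟩ :=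
    exists_output_eq_of_mem_coreConfigs hc₂ hb (z (m + 1)) (alternate α β m)
  obtain ⟨U, g₁, g₂, hg₁, hg₂, hcard, hcore, hout₁, hout₂, hout⟩ :=
    exists_bridge F hi hαβ hK hm (by omega) hz h₁ hN₁ hU₁ h₂ hN₂ hU₂
  obtain ⟨k, hk⟩ : ∃ k, m = 2 * (r + 1) + k + 1 := ⟨m - (2 * (r + 1) + 1), by omega⟩
  have hlink₁ := linkable_follow hF hi hg₁ (hcard.trans hN') (alternate_ne hαβ) nil 0
    (2 * (r + 1)) fun j hj => hcore j (by omega)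
  have hlink₂ := linkable_follow hF hi hg₂ (hcard.trans hN') (alternate_ne hαβ) nil
    (2 * (r + 1) + 1) k fun j hj => hcore j (by omega)
  have hmid : config F r U g₂ (z (2 * (r + 1) + 1)) ∈ coreConfigs F n r (Fin Δ) i N' :=
    ⟨U, g₂, _, hg₂, hcard.trans hN', hcore _ (by omega), rfl⟩
  rw [zero_add, ← hz, hout₁, hout] at hlink₁
  rw [← hz, show 2 * (r + 1) + 1 + k = m by omega, hout₂] at hlink₂
  have := hlink₁.trans (joint_of_map_univ_mem hmid (alternate_ne hαβ _)) hlink₂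
  rwa [← hk] at this

end CorePaths

end Word

section Growth

open Polynomial Filter

theorem exists_forall_eval_le_pow (p : ℕ[X]) : ∃ d, ∀ x, p.eval x ≤ (x + 2) ^ d := by
  induction p using Polynomial.induction_on' with
  | add p q hp hq =>
    obtain ⟨a, ha⟩ := hp
    obtain ⟨b, hb⟩ := hq
    refine ⟨max a b + 1, fun x => ?_⟩
    calc (p + q).eval x = p.eval x + q.eval x := eval_add
      _ ≤ (x + 2) ^ max a b + (x + 2) ^ max a b := by
          gcongr
          · exact (ha x).trans (Nat.pow_le_pow_right (by omega) (le_max_left _ _))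
          · exact (hb x).trans (Nat.pow_le_pow_right (by omega) (le_max_right _ _))
      _ = (x + 2) ^ max a b * 2 := (mul_two _).symm
      _ ≤ (x + 2) ^ (max a b + 1) := Nat.mul_le_mul_left _ (Nat.le_add_left _ _)
  | monomial i c =>
    refine ⟨c + i, fun x => ?_⟩
    calc (monomial i c).eval x = c * x ^ i := eval_monomial
      _ ≤ (x + 2) ^ c * (x + 2) ^ i := Nat.mul_le_mul
          (Nat.lt_pow_self (by omega)).le (Nat.pow_le_pow_left (by omega) i)
      _ = (x + 2) ^ (c + i) := (pow_add _ _ _).symm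

theorem exists_eval_le_of_frequently_le_rpow {t : ℕ → ℕ}
    (ht : ∀ ε : ℝ, 0 < ε → ∃ᶠ n : ℕ in atTop, (t n : ℝ) ≤ (n : ℝ) ^ ε) (p : ℕ[X]) :
    ∃ n, p.eval (t n + 1) ≤ n := by
  obtain ⟨d, hd⟩ := exists_forall_eval_le_pow p
  set ε : ℝ := 1 / (2 * (d + 1)) with hε
  have hε0 : 0 < ε := by positivity
  have hlarge : ∀ᶠ n : ℕ in atTop, 3 ≤ (n : ℝ) ^ ε :=
    ((tendsto_rpow_atTop hε0).comp tendsto_natCast_atTop_atTop).eventually_ge_atTop 3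
  obtain ⟨n, hn, hn3, hn1⟩ := ((ht ε hε0).and_eventually
    (hlarge.and (eventually_ge_atTop 1))).exists
  have hn1' : (1 : ℝ) ≤ n := Nat.one_le_cast.2 hn1
  refine ⟨n, (hd _).trans ?_⟩
  rify
  calc ((t n : ℝ) + 1 + 2) ^ d ≤ ((n : ℝ) ^ ε * (n : ℝ) ^ ε) ^ d := by gcongr; nlinarith
    _ = (n : ℝ) ^ ((ε + ε) * d) := by
        rw [← Real.rpow_add (by linarith), ← Real.rpow_natCast, ← Real.rpow_mul (by linarith)]
    _ ≤ (n : ℝ) ^ (1 : ℝ) := by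
        refine Real.rpow_le_rpow_of_exponent_le hn1' ?_
        rw [hε]
        field_simp
        linarith
    _ = n := Real.rpow_one _

end Growth

theorem exists_eq_succ_of_monotone {X : Type*} {B : Set X} (hB : B.Finite) {s : ℕ → Set X}
    (hs : Monotone s) (hsub : ∀ q ≤ B.ncard, s q ⊆ B) (hne : (s 0).Nonempty) :
    ∃ q < B.ncard, s q = s (q + 1) := by
  by_contra! h
  have hcard : ∀ q ≤ B.ncard, q < (s q).ncard := by
    intro q hq
    induction q with
    | zero => exact (Set.ncard_pos (hB.subset (hsub 0 hq))).2 hne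
    | succ q ih =>
      have hlt : (s q).ncard < (s (q + 1)).ncard := Set.ncard_lt_ncard
        ((hs q.le_succ).ssubset_of_ne (h q hq)) (hB.subset (hsub _ hq))
      have := ih (Nat.le_of_succ_le hq)
      omega
  exact (hcard _ le_rfl).not_ge (Set.ncard_le_ncard (hsub _ le_rfl) hB)

open Word

theorem isFull_coreConfigs {Δ : ℕ} [Nontrivial (Fin Δ)] {Λ : Type*} {P : LCL Δ Λ}
    {F : View → ℕ ⊕ ℕ → Λ} {n r i K N N' : ℕ} (hF : SolvesOrder P F n r) (hi : 1 ≤ i)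
    (hK : ∀ v : Word (Fin Δ), (core (r + 1) i v).card ≤ K)
    (hN' : 2 * N + 2 * (N + 4 * (r + 1) + 2) * K ≤ N') (hn : N' + N ≤ n)
    (hstable : coreConfigs F n r (Fin Δ) (i + 1) N = coreConfigs F n r (Fin Δ) i N') :
    IsFull P (coreConfigs F n r (Fin Δ) i N') (N + 4 * (r + 1) + 3) := by
  have hΔ : 2 ≤ Δ := Fin.nontrivial_iff_two_le.1 inferInstance
  have hsub := coreConfigs_subset (N := N') hF hi
  have hlink := allLinkable_of_le hΔ hsub (M := N + 4 * (r + 1) + 1) fun m hm hm' =>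
    allLinkable_coreConfigs hF hi hK (by omega)
      ((Nat.add_le_add_left (Nat.mul_le_mul_right K (by omega)) _).trans hN') hn hstable
  exact isFull_of_allLinkable hΔ hsub fun m hm => hlink m (by omega)

/-- The number of vertices allowed at the `q`-th step, for cores with at most `K` vertices: one
step joins two trees by a path whose length is at most twice their size plus `O(T)`. -/
def sizeBound (T K q : ℕ) : ℕ := K * (2 * K + 8 * T + 6) ^ q

theorem sizeBound_mono (T K : ℕ) : Monotone (sizeBound T K) := fun _ _ h =>
  Nat.mul_le_mul_left K (Nat.pow_le_pow_right (by omega) h)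

theorem le_sizeBound_succ (T K q : ℕ) :
    2 * sizeBound T K q + 2 * (sizeBound T K q + 4 * T + 2) * K ≤ sizeBound T K (q + 1) := by
  have hK : K ≤ sizeBound T K q := by
    simpa only [sizeBound, pow_zero, mul_one] using sizeBound_mono T K (Nat.zero_le q)
  calc 2 * sizeBound T K q + 2 * (sizeBound T K q + 4 * T + 2) * K
      = sizeBound T K q * (2 * K + 2) + (8 * T + 4) * K := by ring
    _ ≤ sizeBound T K q * (2 * K + 2) + (8 * T + 4) * sizeBound T K q := by gcongr
    _ = sizeBound T K (q + 1) := by rw [sizeBound, sizeBound, pow_succ]; ring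

theorem exists_isFull_of_solvesOrder {Δ : ℕ} (hΔ : 2 ≤ Δ) {Λ : Type*} {P : LCL Δ Λ}
    (hfin : P.vertexConfigs.Finite) {F : View → ℕ ⊕ ℕ → Λ} {n r K : ℕ} (hF : SolvesOrder P F n r)
    (hK : ∀ i ≤ P.vertexConfigs.ncard + 1, ∀ v : Word (Fin Δ), (core (r + 1) i v).card ≤ K)
    (hn : 2 * sizeBound (r + 1) K P.vertexConfigs.ncard ≤ n) :
    ∃ ℓ : ℕ, 2 ≤ ℓ ∧ ∃ S : Set (Multiset Λ), S.Nonempty ∧ IsFull P S ℓ := by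
  have : Nontrivial (Fin Δ) := Fin.nontrivial_iff_two_le.2 hΔ
  set M := P.vertexConfigs.ncard
  let N := sizeBound (r + 1) K
  have hN : Monotone N := sizeBound_mono (r + 1) K
  let s : ℕ → Set (Multiset Λ) := fun q => coreConfigs F n r (Fin Δ) (M + 1 - q) (N q)
  have hs : Monotone s := fun q q' h => coreConfigs_mono (Nat.sub_le_sub_left h _) (hN h)
  have hcard : (core (r + 1) (M + 1) (nil : Word (Fin Δ))).card ≤ N 0 := by
    simpa only [N, sizeBound, pow_zero, mul_one] using hK (M + 1) le_rfl nil
  have hNn : 2 * N M ≤ n := hn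
  have hne : (s 0).Nonempty :=
    coreConfigs_nonempty hcard (hcard.trans (by have := hN (Nat.zero_le M); omega))
  obtain ⟨q, hq, hstable⟩ := exists_eq_succ_of_monotone hfin hs
    (fun q hq => coreConfigs_subset hF (by omega)) hne
  have hN' : N q ≤ N (q + 1) ∧ N (q + 1) ≤ N M := ⟨hN q.le_succ, hN hq⟩
  refine ⟨N q + 4 * (r + 1) + 3, by omega, s (q + 1), hne.mono (hs (Nat.zero_le _)), ?_⟩
  refine isFull_coreConfigs hF (by omega) (hK _ (by omega)) (le_sizeBound_succ (r + 1) K q)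
    (by omega) ?_
  rw [show M + 1 - (q + 1) + 1 = M + 1 - q by omega]
  exact hstable

end RegTreeLCL

open RegTreeLCL Polynomial in
theorem theoremt_general {Δ : ℕ} (hΔ : 2 ≤ Δ) {Λ : Type*} {P : LCL Δ Λ}
    (hfin : P.vertexConfigs.Finite) {t : ℕ → ℕ}
    (ht : ∀ ε : ℝ, 0 < ε → ∃ᶠ n : ℕ in Filter.atTop, (t n : ℝ) ≤ (n : ℝ) ^ ε)
    (hP : HasLocalComplexity P t) :
    ∃ ℓ : ℕ, 2 ≤ ℓ ∧ ∃ S : Set (Multiset Λ), S.Nonempty ∧ IsFull P S ℓ := by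
  set M := P.vertexConfigs.ncard
  let K : ℕ[X] := (C (Δ ^ 2) * (C (2 ^ (M + 1)) * X + 1)) ^ (M + 1)
  obtain ⟨n, hn⟩ := exists_eval_le_of_frequently_le_rpow ht (2 * (K * (2 * K + 8 * X + 6) ^ M))
  have hKeval : K.eval (t n + 1) = (Δ ^ 2 * (2 ^ (M + 1) * (t n + 1) + 1)) ^ (M + 1) := by
    simp [K]
  obtain ⟨F, hF⟩ := hP.exists_solvesOrder n
  refine exists_isFull_of_solvesOrder (K := K.eval (t n + 1)) hΔ hfin hF (fun i hi v => ?_) ?_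
  · have hcore := Word.card_core_le (T := t n + 1) hi v
    rw [Fintype.card_fin] at hcore
    rw [hKeval]
    exact hcore.trans (Nat.pow_le_pow_right (by positivity) hi)
  · simpa [sizeBound] using hn

theorem theoremt {Δ : ℕ} (hΔ : 3 ≤ Δ) {Λ : Type*} [Finite Λ] (P : RegTreeLCL.LCL Δ Λ)
    (hP : RegTreeLCL.InLocalSubpolynomial P) :
    ∃ ℓ : ℕ, 2 ≤ ℓ ∧ ∃ S : Set (Multiset Λ), S.Nonempty ∧ RegTreeLCL.IsFull P S ℓ := by
  obtain ⟨t, ht, hP⟩ := hP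
  exact theoremt_general (by omega) (RegTreeLCL.finite_vertexConfigs P)
    (fun ε hε => (ht ε hε).frequently) hP
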